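/- **Martingale Fishmonger has limiting MVP $H_0/2$.** *The sketch.* Fix $m\ge 1$. The unit square is divided into $m$ columns of width $1/m$, indexed $i=0,\dots,m-1$, with offsets $r_i=i/m$. In column $i$ there is, for every integer $j\ge 0$, a cell occupying the heights $[e^{-(r_i+j+1)},e^{-(r_i+j)})$; the rest of the column, $[e^{-r_i},1)$, is a dummy cell that is always occupied. Each new distinct element throws an independent uniformly random dart at the square (duplicates have no effect). The state $S_{m,k}$ of smoothed base-$e$ PCSA after $k$ distinct elements is the set of non-dummy cells that contain at least one of the first $k$ darts. Let $P_{m,k}=\Pr(S_{m,k}\ne S_{m,k-1}\mid S_{m,k-1})$ be the state changing probability, and let $$E_{m,n}=\sum_{k=1}^{n}\frac{\mathbf 1[S_{m,k}\neq S_{m,k-1}]}{P_{m,k}}$$ be the martingale estimator. The memory of Martingale Fishmonger is that of the entropy-compressed state: the Shannon entropy $H(S_{m,n})$ in bits. The darts used for different values of $m$ may be coupled arbitrarily. Let $$H_0=\frac1{\ln 2}+\sum_{k=1}^\infty \frac{\log_2(1+1/k)}{k}.$$ *The claim.* All $E_{m,n}$ have finite variance and all $S_{m,n}$ have finite entropy.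 In the limits below, $m$ and $\lambda$ range over the positive integers and, for each fixed $\lambda$, the inner limit $m\to\infty$ exists. 1. The sketch is scale-invariant with $\kappa=1$: for every $\lambda$ there is a constant $\kappa_\lambda$ with $\lambda P_{m,\lambda m}\to\kappa_\lambda$ almost surely as $m\to\infty$, and $\kappa_\lambda\to 1$ as $\lambda\to\infty$. 2. The asymptotic relative variance factor is $\displaystyle\lim_{\lambda\to\infty}\lim_{m\to\infty} m\,\frac{\operatorname{Var}(E_{m,\lambda m})}{(\lambda m)^2}=\frac12$, and $\displaystyle\lim_{\lambda\to\infty}\lim_{m\to\infty}\frac{H(S_{m,\lambda m})}{m}=H_0$. 3. The limiting memory-variance product is $$\lim_{\lambda\to\infty}\lim_{m\to\infty} H(S_{m,\lambda m})\cdot\frac{\operatorname{Var}(E_{m,\lambda m})}{(\lambda m)^2}=\frac{H_0}{2}.$$ The same holds if $H(S_{m,\lambda m})$ is replaced by $H(S_{m,\lambda m})+b_{m,\lambda m}$, for any real numbers $b_{m,n}$ with $b_{m,\lambda m}=o(m)$ as $m\to\infty$ for every fixed $\lambda$ (for instance, the word that stores the estimate). 4. $H_0/2\approx 1.63$, that is,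 $|H_0/2-1.63|<0.005$. -/

import Mathlib

open MeasureTheory ProbabilityTheory Filter Topology

namespace Dartboard

/-- A dart is a uniformly random point of the unit square (column coordinate, height coordinate). -/
noncomputable def dartLaw : Measure (ℝ × ℝ) :=
  volume.restrict (Set.Icc (0 : ℝ) 1 ×ˢ Set.Icc (0 : ℝ) 1)

/-- The uniform offset vector `(0, 1/m, 2/m, …, (m-1)/m)`. -/
noncomputable def offset {m : ℕ} (i : Fin m) : ℝ := (i : ℝ) / m

/-- The cells of the smoothed base-`q` partition with `m` columns. In column `i`, the cell
`[q^{-(j+1)}, q^{-j})` is scaled down by the factor `q^{-r_i}`, where `r_i` is the offset. What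
remains of the column, `[q^{-r_i}, 1)`, is the dummy cell, which is always occupied; it is not
recorded in the state. -/
noncomputable def cellRegion (q : ℝ) {m : ℕ} (c : Fin m × ℕ) : Set (ℝ × ℝ) :=
  Set.Ico ((c.1 : ℝ) / m) (((c.1 : ℝ) + 1) / m) ×ˢ
    Set.Ico (q ^ (-(offset c.1 + (c.2 + 1 : ℝ)))) (q ^ (-(offset c.1 + (c.2 : ℝ))))

open Classical in
/-- The cell hit by a dart, and `none` if the dart hits a dummy cell (or one of the boundary
lines of the square that belong to no cell). For `1 < q` the cells are pairwise disjoint, so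
that the choice is unique. -/
noncomputable def cellOf (q : ℝ) (m : ℕ) (y : ℝ × ℝ) : Option (Fin m × ℕ) :=
  if h : ∃ c : Fin m × ℕ, y ∈ cellRegion q c then some h.choose else none

/-- The transition of smoothed `q`-PCSA: the state is the set of (non-dummy) cells that contain
a dart. -/
noncomputable def update (q : ℝ) (m : ℕ) (s : Finset (Fin m × ℕ)) (y : ℝ × ℝ) :
    Finset (Fin m × ℕ) :=
  s ∪ (cellOf q m y).toFinset

/-- The state `S_k` of smoothed `q`-PCSA with `m` columns after `k` distinct elements, whose
darts are `x 0, …, x (k-1)`. -/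
noncomputable def sketch (q : ℝ) (m : ℕ) (x : ℕ → ℝ × ℝ) : ℕ → Finset (Fin m × ℕ)
  | 0 => ∅
  | k + 1 => update q m (sketch q m x k) (x k)

/-- The state changing probability `P_k` (for `k ≥ 1`): the probability that a fresh dart changes
the state `S_{k-1}`. -/
noncomputable def changeProb (q : ℝ) (m : ℕ) (x : ℕ → ℝ × ℝ) (k : ℕ) : ℝ :=
  dartLaw.real {y | update q m (sketch q m x (k - 1)) y ≠ sketch q m x (k - 1)}

/-- The martingale estimator `E_n = ∑_{k=1}^n 1[S_k ≠ S_{k-1}] / P_k`. -/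
noncomputable def martingaleEstimator (q : ℝ) (m : ℕ) (x : ℕ → ℝ × ℝ) (n : ℕ) : ℝ :=
  ∑ k ∈ Finset.Icc 1 n,
    if sketch q m x k ≠ sketch q m x (k - 1) then 1 / changeProb q m x k else 0

/-- The summands of the Shannon entropy, in bits, of a random variable `X` with values in a
countable type. -/
noncomputable def entropyTerm {Ω S : Type*} [MeasurableSpace Ω] (μ : Measure Ω) (X : Ω → S)
    (s : S) : ℝ :=
  -(μ.real (X ⁻¹' {s}) * Real.logb 2 (μ.real (X ⁻¹' {s})))

/-- Shannon entropy in bits. -/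
noncomputable def entropyBits {Ω S : Type*} [MeasurableSpace Ω] (μ : Measure Ω) (X : Ω → S) : ℝ :=
  ∑' s, entropyTerm μ X s

/-- `H₀ = (ln 2)⁻¹ + ∑_{k ≥ 1} k⁻¹ log₂ (1 + 1/k)`. -/
noncomputable def H0 : ℝ :=
  (Real.log 2)⁻¹ + ∑' k : ℕ, ((k : ℝ) + 1)⁻¹ * Real.logb 2 (1 + 1 / ((k : ℝ) + 1))

/-- `lim_{l → ∞} lim_{m → ∞} f l m = a`, where the inner limit exists for every `l ≥ 1`. -/
def HasIteratedLimit (f : ℕ → ℕ → ℝ) (a : ℝ) : Prop :=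
  ∃ L : ℕ → ℝ, (∀ l, 1 ≤ l → Tendsto (fun m => f l m) atTop (𝓝 (L l))) ∧ Tendsto L atTop (𝓝 a)

/-- Scale-invariance with constant `κ` of a family of sketches with `m` subsketches and state
changing probabilities `P m k`: for every `l ≥ 1`, `l * P m (l * m)` converges almost surely to
a constant `κ_l` as `m → ∞`, and `κ_l → κ` as `l → ∞`. -/
def IsScaleInvariant {Ω : Type*} [MeasurableSpace Ω] (μ : Measure Ω) (P : ℕ → ℕ → Ω → ℝ)
    (κ : ℝ) : Prop :=
  ∃ κl : ℕ → ℝ,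
    (∀ l : ℕ, 1 ≤ l → ∀ᵐ ω ∂μ, Tendsto (fun m : ℕ => (l : ℝ) * P m (l * m) ω) atTop (𝓝 (κl l))) ∧
    Tendsto κl atTop (𝓝 κ)

/-- The relative variance `Var(E_{m,n}) / n²` of the martingale estimator of base-`e` smoothed
PCSA with `m` columns after `n` distinct elements; `dart m k` is the dart of the element number
`k + 1` in the sketch with `m` columns. -/
noncomputable def fishmongerRelVar {Ω : Type*} [MeasurableSpace Ω] (μ : Measure Ω)
    (dart : ℕ → ℕ → Ω → ℝ × ℝ) (m n : ℕ) : ℝ :=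
  Var[fun ω => martingaleEstimator (Real.exp 1) m (fun k => dart m k ω) n; μ] / (n : ℝ) ^ 2

/-- The memory, in bits, of the entropy-compressed base-`e` smoothed PCSA sketch with `m` columns
after `n` distinct elements: the Shannon entropy of its state. -/
noncomputable def fishmongerEntropy {Ω : Type*} [MeasurableSpace Ω] (μ : Measure Ω)
    (dart : ℕ → ℕ → Ω → ℝ × ℝ) (m n : ℕ) : ℝ :=
  entropyBits μ (fun ω => sketch (Real.exp 1) m (fun k => dart m k ω) n)

end Dartboard

open Dartboard

namespace Dartboard

/-! A dart matters only through the cell it hits, so the object of study is an iid sequence of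
outcomes in a countable set of cells. The offsets interleave the columns: sorted by decreasing area,
the cells have areas a_k = c e^{-k/m}/m with c = 1 - 1/e (`offset_add`, `dartLaw_real_cellRegion`).
Sums over cells thus become Riemann sums in x = k/m on (0, ∞).

Free area. The state changing probability is the area of the free cells. The conditional expectation
of its final value is a martingale, and each step stays in an interval of length at most 1/m, so
Hoeffding's lemma gives fourth central moments O(1/m²) after O(m) darts. These are summable in m,
whence almost sure convergence under any coupling (`ae_tendsto_freeArea`). The limit after about tm
darts is F(t) = (1 - e^{-ct})/t, and t F(t) → 1, which is κ = 1.

Variance. A jump of size 1/P with probability P has mean 1 and variance 1/P - 1. So E_n - n is a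
martingale and Var E_n is the sum of E[1/P_k] - 1 (`variance_estimate`). In the limit this sum
becomes the integral of 1/F - 1 over [0, l]. As 1/F(x) lies between x and x + 1/c, division by l²
leaves 1/2 + O(1/l).

Entropy. Subadditivity bounds the entropy by the sum of the binary entropies h((1 - a_k)^n). For the
converse, add cells one at a time and condition on the whole record of hits on the earlier cells,
not only on their occupancy (`partialEntropy_insert_ge`). Given the record, the probability that the
new cell is free has variance O(1/m), because the dummy cells keep the total area of the cells away
from 1; so little entropy is lost. Per column the entropy tends to the integral of h(e^{-v}) over x
> 0, where v = T e^{-x} and T = cl. Finally h(e^{-v}) = v e^{-v} + ∑ (e^{-kv} - e^{-(k+1)v})/k over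
k ≥ 1. The first term integrates to 1 - e^{-T}, the others are Frullani integrals tending to log(1 +
1/k)/k, and the total tends to H₀ ln 2 (`tendsto_limitEntropy`). -/

set_option linter.unusedSectionVars false

/-! ### Independent outcomes, occupied cells and the expected free area -/

section Outcomes

/-- The discrete measurable space on the possible outcomes of a dart. -/
instance optionMeasurableSpace {C : Type*} : MeasurableSpace (Option C) := ⊤

instance optionDiscreteMeasurableSpace {C : Type*} : DiscreteMeasurableSpace (Option C) :=
  ⟨fun _ => trivial⟩

/-- Independent outcomes `Y 0, Y 1, …`, all with the law `ν`; the outcome `none` is a miss. -/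
structure IsIIDSequence {Ω C : Type*} [MeasurableSpace Ω] (μ : Measure Ω)
    (ν : Measure (Option C)) (Y : ℕ → Ω → Option C) : Prop where
  measurable : ∀ k, Measurable (Y k)
  law : ∀ k, μ.map (Y k) = ν
  indep : iIndepFun Y μ

/-- The set of cells that are hit by the first `k` outcomes. -/
def occupied {C : Type*} [DecidableEq C] (y : ℕ → Option C) : ℕ → Finset C
  | 0 => ∅
  | k + 1 => occupied y k ∪ (y k).toFinset

/-- `f y` is determined by `y 0, …, y (k-1)`. -/
def DependsOnFirst {C β : Type*} (k : ℕ) (f : (ℕ → Option C) → β) : Prop :=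
  ∀ y y', (∀ i < k, y i = y' i) → f y = f y'

variable {Ω C : Type*} [MeasurableSpace Ω] {μ : Measure Ω} {ν : Measure (Option C)}
  {Y : ℕ → Ω → Option C}

theorem occupied_congr [DecidableEq C] (k : ℕ) :
    DependsOnFirst k (fun y : ℕ → Option C => occupied y k) := by
  intro y y' h
  induction k with
  | zero => rfl
  | succ k ih =>
    simp only [occupied] at ih ⊢
    rw [ih (fun i hi => h i (by omega)), h k (by omega)]

theorem mem_occupied [DecidableEq C] {y : ℕ → Option C} {k : ℕ} {c : C} :
    c ∈ occupied y k ↔ ∃ i < k, y i = some c := by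
  induction k with
  | zero => simp [occupied]
  | succ k ih =>
    simp only [occupied, Finset.mem_union, ih, Option.mem_toFinset, Option.mem_def]
    constructor
    · rintro (⟨i, hi, h⟩ | h)
      · exact ⟨i, by omega, h⟩
      · exact ⟨k, by omega, h⟩
    · rintro ⟨i, hi, h⟩
      rcases Nat.lt_succ_iff_lt_or_eq.1 hi with h' | rfl
      · exact Or.inl ⟨i, h', h⟩
      · exact Or.inr h

theorem card_occupied_le [DecidableEq C] (y : ℕ → Option C) (k : ℕ) :
    (occupied y k).card ≤ k := by
  induction k with
  | zero => simp [occupied]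
  | succ k ih =>
    refine (Finset.card_union_le _ _).trans (add_le_add ih ?_)
    cases y k <;> simp

/-- Extend finitely many outcomes by misses. -/
def extendByMisses {k : ℕ} (z : Finset.range k → Option C) (i : ℕ) : Option C :=
  if h : i ∈ Finset.range k then z ⟨i, h⟩ else none

/-- This factors `f` through finitely many outcomes. They range over a countable discrete space,
where measurability is automatic. -/
theorem DependsOnFirst.eq_extend {β : Type*} {k : ℕ} {f : (ℕ → Option C) → β}
    (hf : DependsOnFirst k f) (y : ℕ → Option C) :
    f y = f (extendByMisses fun i : Finset.range k => y i) := by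
  refine hf _ _ fun i hi => ?_
  simp [extendByMisses, hi]

variable [Countable C]

namespace IsIIDSequence

theorem measurable_of_dependsOnFirst {β : Type*} [MeasurableSpace β] (h : IsIIDSequence μ ν Y)
    {k : ℕ} {f : (ℕ → Option C) → β} (hf : DependsOnFirst k f) :
    Measurable fun ω => f (fun i => Y i ω) := by
  have : (fun ω => f (fun i => Y i ω)) =
      (fun z : Finset.range k → Option C => f (extendByMisses z)) ∘
        fun ω (i : Finset.range k) => Y i ω := by
    funext ω
    exact hf.eq_extend _
  rw [this]
  exact (measurable_of_countable _).comp (measurable_pi_lambda _ fun i => h.measurable i)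

theorem isProbabilityMeasure_law [IsProbabilityMeasure μ] (h : IsIIDSequence μ ν Y) :
    IsProbabilityMeasure ν := by
  rw [← h.law 0]
  exact Measure.isProbabilityMeasure_map (h.measurable 0).aemeasurable

/-- The outcome number `k` is independent of the previous ones. -/
theorem integral_step [IsProbabilityMeasure μ] (h : IsIIDSequence μ ν Y) {k : ℕ}
    {G : (ℕ → Option C) → Option C → ℝ} (hG : DependsOnFirst k G) {B : ℝ}
    (hB : ∀ y o, |G y o| ≤ B) :
    ∫ ω, G (fun i => Y i ω) (Y k ω) ∂μ = ∫ ω, ∫ o, G (fun i => Y i ω) o ∂ν ∂μ := by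
  have := h.isProbabilityMeasure_law
  set U : Ω → (Finset.range k → Option C) := fun ω i => Y i ω with hU
  have hUm : Measurable U := measurable_pi_lambda _ fun i => h.measurable i
  have hind : IndepFun U (Y k) μ := by
    have := h.indep.indepFun_finset (Finset.range k) {k} (by simp) h.measurable
    exact this.comp (φ := id) (ψ := fun z : (({k} : Finset ℕ) → Option C) => z ⟨k, by simp⟩)
      measurable_id (measurable_pi_apply _)
  have hmap := (indepFun_iff_map_prod_eq_prod_map_map hUm.aemeasurable
    (h.measurable k).aemeasurable).1 hind
  rw [h.law k] at hmap
  have : IsProbabilityMeasure (μ.map U) := Measure.isProbabilityMeasure_map hUm.aemeasurable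
  set G' : (Finset.range k → Option C) → Option C → ℝ := fun z o => G (extendByMisses z) o
  have e : ∀ ω o, G (fun i => Y i ω) o = G' (U ω) o := fun ω o => by
    rw [hG.eq_extend]
  have hG'm : Measurable (Function.uncurry G') := measurable_of_countable _
  simp_rw [e]
  calc ∫ ω, G' (U ω) (Y k ω) ∂μ
      = ∫ p, Function.uncurry G' p ∂(μ.map fun ω => (U ω, Y k ω)) := by
        rw [integral_map (hUm.prodMk (h.measurable k)).aemeasurable
          hG'm.aestronglyMeasurable]
        rfl
    _ = ∫ z, ∫ o, G' z o ∂ν ∂(μ.map U) := by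
        rw [hmap, integral_prod]
        · rfl
        · refine Integrable.of_bound hG'm.aestronglyMeasurable B (ae_of_all _ fun p => ?_)
          exact hB _ _
    _ = _ := by
        rw [integral_map hUm.aemeasurable]
        exact (measurable_of_countable _).aestronglyMeasurable

theorem integrable_of_dependsOnFirst [IsFiniteMeasure μ] (h : IsIIDSequence μ ν Y) {k : ℕ}
    {f : (ℕ → Option C) → ℝ} (hf : DependsOnFirst k f) {B : ℝ} (hB : ∀ y, |f y| ≤ B) :
    Integrable (fun ω => f (fun i => Y i ω)) μ :=
  Integrable.of_bound (h.measurable_of_dependsOnFirst hf).aestronglyMeasurable B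
    (ae_of_all _ fun _ => hB _)

theorem measureReal_forall_mem [IsProbabilityMeasure μ] (h : IsIIDSequence μ ν Y) (k : ℕ)
    (B : ℕ → Set (Option C)) :
    μ.real {ω | ∀ i < k, Y i ω ∈ B i} = ∏ i ∈ Finset.range k, ν.real (B i) := by
  have h1 := h.indep.measure_inter_preimage_eq_mul (Finset.range k) (sets := B)
    (fun i _ => MeasurableSet.of_discrete)
  have h2 : {ω | ∀ i < k, Y i ω ∈ B i} = ⋂ i ∈ Finset.range k, Y i ⁻¹' B i := by
    ext ω
    simp
  rw [h2, measureReal_def, h1, ENNReal.toReal_prod]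
  refine Finset.prod_congr rfl fun i _ => ?_
  rw [measureReal_def, ← h.law i, Measure.map_apply (h.measurable i) MeasurableSet.of_discrete]

end IsIIDSequence

/-- The probability that the next outcome hits a cell outside `s`. -/
noncomputable def freeArea (ν : Measure (Option C)) (s : Finset C) : ℝ :=
  ν.real {o | ∃ c ∉ s, o = some c}

/-- The expected probability of a hit outside `s` after `k` more outcomes. -/
noncomputable def expectedFreeArea [DecidableEq C] (ν : Measure (Option C)) (k : ℕ)
    (s : Finset C) : ℝ :=
  ∑' c, if c ∈ s then 0 else ν.real {some c} * (1 - ν.real {some c}) ^ k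

theorem summable_real_some [IsProbabilityMeasure ν] :
    Summable fun c => ν.real {some c} := by
  have h := (hasSum_integral_iUnion (μ := ν) (f := fun _ => (1 : ℝ))
    (s := fun c : C => ({some c} : Set (Option C))) (fun _ => MeasurableSet.of_discrete)
    (fun a b hab => by simp [Function.onFun, hab])
    (integrable_const _).integrableOn).summable
  simpa [measureReal_def] using h

theorem real_some_le_one [IsProbabilityMeasure ν] (c : C) : ν.real {some c} ≤ 1 :=
  measureReal_le_one

/-- The law is atomic, and the atom `none` contributes nothing because `g` vanishes there. -/
theorem integral_option [IsProbabilityMeasure ν] {g : Option C → ℝ} {B : ℝ}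
    (hB : ∀ o, |g o| ≤ B) (h0 : g none = 0) :
    ∫ o, g o ∂ν = ∑' c, ν.real {some c} * g (some c) := by
  have hd : Pairwise (Function.onFun Disjoint fun c : C => ({some c} : Set (Option C))) :=
    fun a b hab => by simp [Function.onFun, hab]
  have hi : Integrable g ν :=
    Integrable.of_bound (measurable_of_countable _).aestronglyMeasurable B (ae_of_all _ hB)
  have h := (hasSum_integral_iUnion (μ := ν) (f := g)
    (s := fun c : C => ({some c} : Set (Option C))) (fun _ => MeasurableSet.of_discrete) hd
    hi.integrableOn).tsum_eq
  have h2 : ∫ o in (⋃ c : C, ({some c} : Set (Option C))), g o ∂ν = ∫ o, g o ∂ν := by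
    refine setIntegral_eq_integral_of_forall_compl_eq_zero fun o ho => ?_
    cases o with
    | none => exact h0
    | some c => simp at ho
  rw [← h2, ← h]
  refine tsum_congr fun c => ?_
  simp [Measure.restrict_singleton, measureReal_def]

theorem freeArea_eq [IsProbabilityMeasure ν] [DecidableEq C] (s : Finset C) :
    freeArea ν s = expectedFreeArea ν 0 s := by
  classical
  have h := integral_option (ν := ν) (g := Set.indicator {o | ∃ c ∉ s, o = some c} 1) (B := 1)
    (fun o => by by_cases h : o ∈ {o | ∃ c ∉ s, o = some c} <;> simp [Set.indicator, h])
    (by simp)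
  rw [integral_indicator_one MeasurableSet.of_discrete] at h
  rw [freeArea, h, expectedFreeArea]
  refine tsum_congr fun c => ?_
  by_cases hc : c ∈ s <;> simp [Set.indicator, hc]

theorem summable_expectedFreeArea [IsProbabilityMeasure ν] [DecidableEq C] (k : ℕ) (s : Finset C) :
    Summable fun c => if c ∈ s then 0 else ν.real {some c} * (1 - ν.real {some c}) ^ k := by
  refine Summable.of_nonneg_of_le (fun c => ?_) (fun c => ?_) (summable_real_some (ν := ν))
  · split_ifs
    · rfl
    · exact mul_nonneg measureReal_nonneg (pow_nonneg (sub_nonneg.2 (real_some_le_one c)) _)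
  · split_ifs
    · exact measureReal_nonneg
    · exact mul_le_of_le_one_right measureReal_nonneg (pow_le_one₀
        (sub_nonneg.2 (real_some_le_one c))
        (by linarith [measureReal_nonneg (μ := ν) (s := {some c})]))

theorem expectedFreeArea_union [IsProbabilityMeasure ν] [DecidableEq C] (k : ℕ) (s : Finset C)
    (o : Option C) :
    expectedFreeArea ν k (s ∪ o.toFinset) = expectedFreeArea ν k s -
      o.elim 0 (fun c => if c ∈ s then 0 else ν.real {some c} * (1 - ν.real {some c}) ^ k) := by
  cases o with
  | none => simp
  | some c =>
    simp only [Option.toFinset_some, Option.elim_some]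
    by_cases hc : c ∈ s
    · simp [hc, Finset.union_eq_left.2 (Finset.singleton_subset_iff.2 hc)]
    · rw [expectedFreeArea, expectedFreeArea, (summable_expectedFreeArea k s).tsum_eq_add_tsum_ite c]
      rw [add_sub_cancel_left]
      refine tsum_congr fun d => ?_
      by_cases hd : d = c <;> simp [hd]

/-- The martingale property: a free cell of area a stays free after one more outcome with
probability 1 - a, which supplies one more factor 1 - a in its summand. -/
theorem integral_expectedFreeArea_union [IsProbabilityMeasure ν] [DecidableEq C] (k : ℕ)
    (s : Finset C) :
    ∫ o, expectedFreeArea ν k (s ∪ o.toFinset) ∂ν = expectedFreeArea ν (k + 1) s := by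
  have hb : ∀ c, |if c ∈ s then 0 else ν.real {some c} * (1 - ν.real {some c}) ^ k| ≤ 1 := by
    intro c
    have h0 := measureReal_nonneg (μ := ν) (s := {some c})
    have h1 := real_some_le_one (ν := ν) c
    split_ifs
    · simp
    · rw [abs_of_nonneg (mul_nonneg h0 (pow_nonneg (by linarith) _))]
      exact mul_le_one₀ h1 (pow_nonneg (by linarith) _) (pow_le_one₀ (by linarith) (by linarith))
  have hb' : ∀ o : Option C, |o.elim 0
      (fun c => if c ∈ s then 0 else ν.real {some c} * (1 - ν.real {some c}) ^ k)| ≤ 1 := by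
    rintro (_ | c)
    · simp
    · exact hb c
  simp_rw [expectedFreeArea_union]
  rw [integral_sub (integrable_const _) (Integrable.of_bound
    (measurable_of_countable _).aestronglyMeasurable 1 (ae_of_all _ hb')),
    integral_option hb' (by simp)]
  simp only [integral_const, probReal_univ, one_smul, Option.elim_some]
  rw [expectedFreeArea, expectedFreeArea, ← (summable_expectedFreeArea k s).tsum_sub]
  · refine tsum_congr fun c => ?_
    split_ifs
    · simp
    · ring
  · refine (summable_real_some (ν := ν)).of_norm_bounded fun c => ?_
    rw [norm_mul, Real.norm_of_nonneg measureReal_nonneg]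
    exact mul_le_of_le_one_right measureReal_nonneg (hb c)

end Outcomes

/-! ### Concentration of the free area -/

section Concentration

variable {Ω C : Type*} [MeasurableSpace Ω] {μ : Measure Ω} {ν : Measure (Option C)}
  {Y : ℕ → Ω → Option C} [Countable C] [DecidableEq C]

theorem expectedFreeArea_nonneg [IsProbabilityMeasure ν] (k : ℕ) (s : Finset C) :
    0 ≤ expectedFreeArea ν k s := by
  refine tsum_nonneg fun c => ?_
  split_ifs
  · rfl
  · exact mul_nonneg measureReal_nonneg (pow_nonneg (sub_nonneg.2 (real_some_le_one c)) _)

theorem freeArea_nonneg (s : Finset C) : 0 ≤ freeArea ν s := measureReal_nonneg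

theorem freeArea_le_one [IsProbabilityMeasure ν] (s : Finset C) : freeArea ν s ≤ 1 :=
  measureReal_le_one

theorem expectedFreeArea_le_one [IsProbabilityMeasure ν] (k : ℕ) (s : Finset C) :
    expectedFreeArea ν k s ≤ 1 := by
  refine le_trans ?_ (freeArea_le_one (ν := ν) s)
  rw [freeArea_eq]
  refine (summable_expectedFreeArea k s).tsum_le_tsum (fun c => ?_) (summable_expectedFreeArea 0 s)
  split_ifs
  · rfl
  · rw [pow_zero, mul_one]
    exact mul_le_of_le_one_right measureReal_nonneg (pow_le_one₀
        (sub_nonneg.2 (real_some_le_one c))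
        (by linarith [measureReal_nonneg (μ := ν) (s := {some c})]))

theorem abs_expectedFreeArea_le [IsProbabilityMeasure ν] (k : ℕ) (s : Finset C) :
    |expectedFreeArea ν k s| ≤ 1 := by
  rw [abs_of_nonneg (expectedFreeArea_nonneg k s)]
  exact expectedFreeArea_le_one k s

theorem exp_mul_expectedFreeArea_le [IsProbabilityMeasure ν] (θ : ℝ) (k : ℕ) (s : Finset C) :
    |Real.exp (θ * expectedFreeArea ν k s)| ≤ Real.exp |θ| := by
  rw [abs_of_pos (Real.exp_pos _), Real.exp_le_exp]
  refine (le_abs_self _).trans ?_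
  rw [abs_mul]
  exact mul_le_of_le_one_right (abs_nonneg _) (abs_expectedFreeArea_le k s)

/-- Hoeffding's lemma for one step: an outcome removes at most one summand, and that summand lies
between 0 and `A`. -/
theorem integral_exp_union_le [IsProbabilityMeasure ν] {A : ℝ} (hA : ∀ c, ν.real {some c} ≤ A)
    (hA0 : 0 ≤ A) (θ : ℝ) (j : ℕ) (s : Finset C) :
    ∫ o, Real.exp (θ * expectedFreeArea ν j (s ∪ o.toFinset)) ∂ν ≤
      Real.exp (θ * expectedFreeArea ν (j + 1) s) * Real.exp (θ ^ 2 * A ^ 2 / 8) := by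
  set X : Option C → ℝ := fun o => expectedFreeArea ν j (s ∪ o.toFinset)
  have hX : ∀ o, X o ∈ Set.Icc (expectedFreeArea ν j s - A) (expectedFreeArea ν j s) := by
    intro o
    simp only [X, expectedFreeArea_union]
    have key : 0 ≤ o.elim 0 (fun c => if c ∈ s then 0 else
          ν.real {some c} * (1 - ν.real {some c}) ^ j) ∧
        o.elim 0 (fun c => if c ∈ s then 0 else
          ν.real {some c} * (1 - ν.real {some c}) ^ j) ≤ A := by
      cases o with
      | none => simpa using hA0
      | some c =>
        have h0 := measureReal_nonneg (μ := ν) (s := {some c})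
        have h1 := sub_nonneg.2 (real_some_le_one (ν := ν) c)
        simp only [Option.elim_some]
        split_ifs
        · exact ⟨le_rfl, hA0⟩
        · exact ⟨mul_nonneg h0 (pow_nonneg h1 _),
            (mul_le_of_le_one_right h0 (pow_le_one₀ h1 (by linarith))).trans (hA c)⟩
    exact ⟨by linarith [key.2], by linarith [key.1]⟩
  have hm := (hasSubgaussianMGF_of_mem_Icc (μ := ν) (X := X)
    (measurable_of_countable _).aemeasurable (ae_of_all _ hX)).mgf_le θ
  rw [integral_expectedFreeArea_union, mgf] at hm
  calc ∫ o, Real.exp (θ * X o) ∂ν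
      = Real.exp (θ * expectedFreeArea ν (j + 1) s) *
          ∫ o, Real.exp (θ * (X o - expectedFreeArea ν (j + 1) s)) ∂ν := by
        rw [← integral_const_mul]
        refine integral_congr_ae (ae_of_all _ fun o => ?_)
        simp only
        rw [← Real.exp_add]
        congr 1
        ring
    _ ≤ _ := by
        refine mul_le_mul_of_nonneg_left (hm.trans_eq ?_) (Real.exp_pos _).le
        congr 1
        simp only [sub_sub_cancel, NNReal.coe_pow, NNReal.coe_div, coe_nnnorm, Real.norm_eq_abs,
          abs_of_nonneg hA0, NNReal.coe_ofNat]
        ring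

/-- The last outcome is integrated out first. This turns the horizon `j` into `j + 1` and costs one
Hoeffding factor, hence the induction with `j` generalized. -/
theorem IsIIDSequence.integral_exp_expectedFreeArea_le [IsProbabilityMeasure μ]
    (h : IsIIDSequence μ ν Y) {A : ℝ} (hA : ∀ c, ν.real {some c} ≤ A) (hA0 : 0 ≤ A) (θ : ℝ)
    (k j : ℕ) :
    ∫ ω, Real.exp (θ * expectedFreeArea ν j (occupied (fun i => Y i ω) k)) ∂μ ≤
      Real.exp (θ * expectedFreeArea ν (j + k) (∅ : Finset C) + k * (θ ^ 2 * A ^ 2 / 8)) := by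
  have := h.isProbabilityMeasure_law
  induction k generalizing j with
  | zero => simp [occupied]
  | succ k ih =>
    have e := h.integral_step (k := k)
      (G := fun y o => Real.exp (θ * expectedFreeArea ν j (occupied y k ∪ o.toFinset)))
      (B := Real.exp |θ|) (fun y y' hy => by simp only [occupied_congr k y y' hy])
      (fun y o => exp_mul_expectedFreeArea_le _ _ _)
    simp only [occupied]
    rw [e]
    have hi : Integrable (fun ω =>
        Real.exp (θ * expectedFreeArea ν (j + 1) (occupied (fun i => Y i ω) k))) μ :=
      h.integrable_of_dependsOnFirst (k := k)
        (f := fun y => Real.exp (θ * expectedFreeArea ν (j + 1) (occupied y k)))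
        (fun y y' hy => by simp only [occupied_congr k y y' hy])
        (fun y => exp_mul_expectedFreeArea_le _ _ _)
    calc _ ≤ ∫ ω, Real.exp (θ * expectedFreeArea ν (j + 1) (occupied (fun i => Y i ω) k)) *
          Real.exp (θ ^ 2 * A ^ 2 / 8) ∂μ := by
          refine integral_mono_of_nonneg (ae_of_all _ fun ω => integral_nonneg fun o =>
            (Real.exp_pos _).le) (hi.mul_const _) (ae_of_all _ fun ω => ?_)
          exact integral_exp_union_le hA hA0 θ j _
      _ ≤ _ := by
          rw [integral_mul_const]
          refine (mul_le_mul_of_nonneg_right (ih (j + 1)) (Real.exp_pos _).le).trans_eq ?_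
          rw [← Real.exp_add]
          congr 1
          push_cast
          rw [show j + 1 + k = j + (k + 1) by ring]
          ring

/-- Turns exponential moments at θ and -θ into a fourth moment; the constant is 4!. -/
theorem pow_four_le_exp_add_exp (x : ℝ) : x ^ 4 ≤ 24 * (Real.exp x + Real.exp (-x)) := by
  have h := Real.pow_div_factorial_le_exp |x| (abs_nonneg x) 4
  have h2 : |x| ^ 4 = x ^ 4 := by rw [show (4 : ℕ) = 2 * 2 by rfl, pow_mul, sq_abs, ← pow_mul]
  have h3 : Real.exp |x| ≤ Real.exp x + Real.exp (-x) := by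
    rcases abs_cases x with ⟨e, _⟩ | ⟨e, _⟩ <;> rw [e] <;>
      linarith [Real.exp_pos x, Real.exp_pos (-x)]
  rw [h2] at h
  norm_num [Nat.factorial] at h
  linarith

/-- Fourth moment bound for the deviation of the free area from its mean. -/
theorem IsIIDSequence.integral_pow_four_le [IsProbabilityMeasure μ]
    (h : IsIIDSequence μ ν Y) {A : ℝ} (hA : ∀ c, ν.real {some c} ≤ A) (hA0 : 0 ≤ A) (θ : ℝ)
    (k : ℕ) :
    θ ^ 4 * ∫ ω, (freeArea ν (occupied (fun i => Y i ω) k) -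
        expectedFreeArea ν k (∅ : Finset C)) ^ 4 ∂μ ≤ 48 * Real.exp (k * (θ ^ 2 * A ^ 2 / 8)) := by
  have := h.isProbabilityMeasure_law
  set e := expectedFreeArea ν k (∅ : Finset C)
  set X : Ω → ℝ := fun ω => expectedFreeArea ν 0 (occupied (fun i => Y i ω) k)
  have hi : ∀ t : ℝ, Integrable (fun ω => Real.exp (t * X ω)) μ := fun t =>
      h.integrable_of_dependsOnFirst (k := k)
        (f := fun y => Real.exp (t * expectedFreeArea ν 0 (occupied y k)))
        (fun y y' hy => by simp only [occupied_congr k y y' hy])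
        (fun y => exp_mul_expectedFreeArea_le _ _ _)
  have hexp : ∀ t : ℝ, ∫ ω, Real.exp (t * X ω) * Real.exp (-(t * e)) ∂μ ≤
      Real.exp (k * (t ^ 2 * A ^ 2 / 8)) := by
    intro t
    rw [integral_mul_const]
    have := h.integral_exp_expectedFreeArea_le hA hA0 t k 0
    rw [zero_add] at this
    refine (mul_le_mul_of_nonneg_right this (Real.exp_pos _).le).trans_eq ?_
    rw [← Real.exp_add]
    congr 1
    ring
  have h1 := hexp θ
  have h2 := hexp (-θ)
  rw [neg_sq] at h2
  rw [← integral_const_mul]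
  calc _ ≤ ∫ ω, 24 * (Real.exp (θ * X ω) * Real.exp (-(θ * e)) +
        Real.exp (-θ * X ω) * Real.exp (-(-θ * e))) ∂μ := by
        refine integral_mono_of_nonneg (ae_of_all _ fun ω => ?_)
          ((((hi _).mul_const _).add ((hi _).mul_const _)).const_mul _) (ae_of_all _ fun ω => ?_)
        · exact mul_nonneg (by positivity) (by positivity)
        · simp only [freeArea_eq]
          rw [← mul_pow, ← Real.exp_add, ← Real.exp_add]
          refine (pow_four_le_exp_add_exp _).trans_eq ?_
          congr 3 <;> simp only [X, e] <;> ring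
    _ ≤ _ := by
        rw [integral_const_mul, integral_add ((hi _).mul_const _) ((hi _).mul_const _)]
        linarith

/-- A sequence with summable fourth moments tends to zero almost surely. -/
theorem ae_tendsto_zero_of_summable_pow_four {X : ℕ → Ω → ℝ}
    (hi : ∀ m, Integrable (fun ω => X m ω ^ 4) μ) (hs : Summable fun m => ∫ ω, X m ω ^ 4 ∂μ) :
    ∀ᵐ ω ∂μ, Tendsto (fun m => X m ω) atTop (𝓝 0) := by
  have h4 : ∀ m ω, 0 ≤ X m ω ^ 4 := fun m ω => by positivity
  have hl : ∀ m, ∫⁻ ω, ENNReal.ofReal (X m ω ^ 4) ∂μ = ENNReal.ofReal (∫ ω, X m ω ^ 4 ∂μ) :=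
    fun m => (ofReal_integral_eq_lintegral_ofReal (hi m) (ae_of_all _ (h4 m))).symm
  have hm : ∀ m, AEMeasurable (fun ω => ENNReal.ofReal (X m ω ^ 4)) μ :=
    fun m => (hi m).aestronglyMeasurable.aemeasurable.ennreal_ofReal
  -- The sum of all fourth powers has finite expectation, so it is finite almost surely and its
  -- terms tend to zero. The joint law of different indices plays no role; two square roots then
  -- undo the power.
  have hfin : ∫⁻ ω, ∑' m, ENNReal.ofReal (X m ω ^ 4) ∂μ ≠ ⊤ := by
    rw [lintegral_tsum hm]
    simp_rw [hl]
    exact hs.tsum_ofReal_ne_top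
  filter_upwards [ae_lt_top' (AEMeasurable.tsum hm) hfin] with ω hω
  have h5 := ENNReal.tendsto_atTop_zero_of_tsum_ne_top hω.ne
  have h6 : Tendsto (fun m => X m ω ^ 4) atTop (𝓝 0) := by
    have := (ENNReal.tendsto_toReal ENNReal.zero_ne_top).comp h5
    simpa [Function.comp_def, ENNReal.toReal_ofReal, h4] using this
  have h7 : Tendsto (fun m => √(X m ω ^ 4)) atTop (𝓝 0) := by
    simpa [Function.comp_def] using (Real.continuous_sqrt.tendsto 0).comp h6
  have h8 : Tendsto (fun m => √√(X m ω ^ 4)) atTop (𝓝 0) := by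
    simpa [Function.comp_def] using (Real.continuous_sqrt.tendsto 0).comp h7
  rw [tendsto_zero_iff_abs_tendsto_zero]
  refine h8.congr fun m => ?_
  rw [show X m ω ^ 4 = (X m ω ^ 2) ^ 2 by ring, Real.sqrt_sq (sq_nonneg _), Real.sqrt_sq_eq_abs]
  rfl

end Concentration

/-! ### Mean and variance of the martingale estimator -/

section Estimator

variable {Ω C : Type*} [MeasurableSpace Ω] {μ : Measure Ω} {ν : Measure (Option C)}
  {Y : ℕ → Ω → Option C} [Countable C] [DecidableEq C]

/-- The martingale estimator as a function of the outcomes. -/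
noncomputable def estimate (ν : Measure (Option C)) (y : ℕ → Option C) (n : ℕ) : ℝ :=
  ∑ k ∈ Finset.range n,
    if occupied y (k + 1) ≠ occupied y k then 1 / freeArea ν (occupied y k) else 0

theorem union_toFinset_ne_iff {s : Finset C} {o : Option C} :
    s ∪ o.toFinset ≠ s ↔ ∃ c ∉ s, o = some c := by
  cases o with
  | none => simp
  | some c => simp

theorem estimate_succ (y : ℕ → Option C) (n : ℕ) :
    estimate ν y (n + 1) = estimate ν y n +
      Set.indicator {o | ∃ c ∉ occupied y n, o = some c}
        (fun _ => 1 / freeArea ν (occupied y n)) (y n) := by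
  classical
  rw [estimate, Finset.sum_range_succ, ← estimate]
  congr 1
  rw [Set.indicator_apply]
  refine if_congr ?_ rfl rfl
  rw [occupied, union_toFinset_ne_iff]
  rfl

theorem estimate_congr (n : ℕ) : DependsOnFirst n (fun y : ℕ → Option C => estimate ν y n) := by
  intro y y' h
  refine Finset.sum_congr rfl fun k hk => ?_
  have hk' := Finset.mem_range.1 hk
  simp only [occupied_congr (k + 1) y y' fun i hi => h i (by omega),
    occupied_congr k y y' fun i hi => h i (by omega)]

theorem abs_estimate_le {δ : ℝ} (hδ : 0 < δ) {n : ℕ}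
    (hF : ∀ k < n, ∀ y : ℕ → Option C, δ ≤ freeArea ν (occupied y k)) (y : ℕ → Option C) :
    |estimate ν y n| ≤ n * (1 / δ) := by
  refine (Finset.abs_sum_le_sum_abs _ _).trans ?_
  refine (Finset.sum_le_card_nsmul _ _ (1 / δ) fun k hk => ?_).trans_eq (by simp)
  have h := hF k (Finset.mem_range.1 hk) y
  split_ifs
  · rw [abs_of_nonneg (one_div_nonneg.2 (hδ.le.trans h))]
    exact one_div_le_one_div_of_le hδ h
  · rw [abs_zero]
    exact (one_div_pos.2 hδ).le

/-- A jump of size 1/P that happens with probability P has mean 1, so the centred estimator is a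
martingale. -/
theorem integral_linear_step [IsProbabilityMeasure ν] {N : Set (Option C)} (hN : 0 < ν.real N)
    (x : ℝ) :
    ∫ o, (x + N.indicator (fun _ => 1 / ν.real N) o - 1) ∂ν = x := by
  have hi : Integrable (N.indicator fun _ : Option C => 1 / ν.real N) ν :=
    (integrable_const _).indicator MeasurableSet.of_discrete
  have hx : Integrable (fun _ : Option C => x - 1) ν := integrable_const _
  have : ∀ o, x + N.indicator (fun _ => 1 / ν.real N) o - 1 =
      (x - 1) + N.indicator (fun _ => 1 / ν.real N) o := fun o => by ring
  simp_rw [this]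
  rw [integral_add hx hi, integral_indicator_const _ MeasurableSet.of_discrete]
  simp
  field_simp
  ring

/-- The centred jump has mean 0 and variance 1/P - 1; there is no cross term. -/
theorem integral_quadratic_step [IsProbabilityMeasure ν] {N : Set (Option C)} (hN : 0 < ν.real N)
    (x : ℝ) :
    ∫ o, (x + N.indicator (fun _ => 1 / ν.real N) o - 1) ^ 2 ∂ν =
      x ^ 2 + (1 / ν.real N - 1) := by
  set r := 1 / ν.real N
  have hi : Integrable (N.indicator fun _ : Option C => 2 * (x - 1) * r + r ^ 2) ν :=
    (integrable_const _).indicator MeasurableSet.of_discrete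
  have hx : Integrable (fun _ : Option C => (x - 1) ^ 2) ν := integrable_const _
  have : ∀ o, (x + N.indicator (fun _ => r) o - 1) ^ 2 =
      (x - 1) ^ 2 + N.indicator (fun _ => 2 * (x - 1) * r + r ^ 2) o := fun o => by
    by_cases h : o ∈ N <;> simp [h]
    ring
  simp_rw [this]
  rw [integral_add hx hi, integral_indicator_const _ MeasurableSet.of_discrete]
  simp [r]
  field_simp
  ring

namespace IsIIDSequence

theorem integrable_inv_freeArea [IsProbabilityMeasure μ] (h : IsIIDSequence μ ν Y) {δ : ℝ}
    (hδ : 0 < δ) {k : ℕ} (hF : ∀ y : ℕ → Option C, δ ≤ freeArea ν (occupied y k)) :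
    Integrable (fun ω => 1 / freeArea ν (occupied (fun i => Y i ω) k)) μ := by
  refine h.integrable_of_dependsOnFirst (k := k) (f := fun y => 1 / freeArea ν (occupied y k))
    (fun y y' hy => by simp only [occupied_congr k y y' hy]) (B := 1 / δ) fun y => ?_
  rw [abs_of_nonneg (one_div_nonneg.2 (hδ.le.trans (hF y)))]
  exact one_div_le_one_div_of_le hδ (hF y)

/-- Martingale increments are orthogonal, so the conditional variances 1/P - 1 add up. The lower
bound `δ` makes every quantity bounded and hence integrable. -/
theorem estimate_moments [IsProbabilityMeasure μ] (h : IsIIDSequence μ ν Y) {δ : ℝ} (hδ : 0 < δ)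
    {n : ℕ} (hF : ∀ k < n, ∀ y : ℕ → Option C, δ ≤ freeArea ν (occupied y k)) :
    ∫ ω, (estimate ν (fun i => Y i ω) n - n) ∂μ = 0 ∧
    ∫ ω, (estimate ν (fun i => Y i ω) n - n) ^ 2 ∂μ =
      ∑ k ∈ Finset.range n, (∫ ω, 1 / freeArea ν (occupied (fun i => Y i ω) k) ∂μ - 1) := by
  have := h.isProbabilityMeasure_law
  induction n with
  | zero => simp [estimate]
  | succ n ih =>
    obtain ⟨ih1, ih2⟩ := ih fun k hk => hF k (by omega)
    have hFn := hF n (by omega)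
    have hb : ∀ y o, |(estimate ν y n - n) + Set.indicator {o | ∃ c ∉ occupied y n, o = some c}
        (fun _ => 1 / freeArea ν (occupied y n)) o - 1| ≤ n * (1 / δ) + n + 1 / δ + 1 := by
      intro y o
      have h1 := abs_le.1 (abs_estimate_le hδ (fun k hk => hF k (by omega)) y (n := n))
      have h2 : 0 ≤ Set.indicator {o | ∃ c ∉ occupied y n, o = some c}
          (fun _ => 1 / freeArea ν (occupied y n)) o :=
        Set.indicator_nonneg (fun _ _ => one_div_nonneg.2 (freeArea_nonneg _)) _
      have h3 : Set.indicator {o | ∃ c ∉ occupied y n, o = some c}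
          (fun _ => 1 / freeArea ν (occupied y n)) o ≤ 1 / δ :=
        Set.indicator_apply_le' (fun _ => one_div_le_one_div_of_le hδ (hFn y))
          (fun _ => (one_div_pos.2 hδ).le)
      have h4 : (0 : ℝ) ≤ n := n.cast_nonneg
      rw [abs_le]
      constructor <;> linarith [h1.1, h1.2]
    have hdep : DependsOnFirst n (fun (y : ℕ → Option C) (o : Option C) =>
        (estimate ν y n - n) + Set.indicator {o | ∃ c ∉ occupied y n, o = some c}
        (fun _ => 1 / freeArea ν (occupied y n)) o - 1) := fun y y' hy => by
      simp only [occupied_congr n y y' hy, estimate_congr n y y' hy]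
    have e : ∀ y : ℕ → Option C, estimate ν y (n + 1) - ((n + 1 : ℕ) : ℝ) =
        (estimate ν y n - n) + Set.indicator {o | ∃ c ∉ occupied y n, o = some c}
        (fun _ => 1 / freeArea ν (occupied y n)) (y n) - 1 := fun y => by
      rw [estimate_succ]
      push_cast
      ring
    simp_rw [e]
    constructor
    · rw [h.integral_step hdep hb, ← ih1]
      refine integral_congr_ae (ae_of_all _ fun ω => ?_)
      exact integral_linear_step (hδ.trans_le (hFn _)) _
    · have h2 := h.integral_step (k := n) (G := fun (y : ℕ → Option C) (o : Option C) =>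
        ((estimate ν y n - n) + Set.indicator {o | ∃ c ∉ occupied y n, o = some c}
        (fun _ => 1 / freeArea ν (occupied y n)) o - 1) ^ 2)
        (B := (n * (1 / δ) + n + 1 / δ + 1) ^ 2)
        (fun y y' hy => by
          funext o
          simp only [congrFun (hdep y y' hy) o])
        (fun y o => by rw [abs_pow]; exact pow_le_pow_left₀ (abs_nonneg _) (hb y o) 2)
      rw [h2, Finset.sum_range_succ, ← ih2, show ∀ I : ℝ, I - 1 = I - ∫ _, (1 : ℝ) ∂μ by simp,
        ← integral_sub (h.integrable_inv_freeArea hδ hFn) (integrable_const _), ← integral_add]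
      · refine integral_congr_ae (ae_of_all _ fun ω => ?_)
        exact integral_quadratic_step (hδ.trans_le (hFn _)) _
      · refine h.integrable_of_dependsOnFirst (k := n) (f := fun y => (estimate ν y n - n) ^ 2)
          (B := (n * (1 / δ) + n) ^ 2)
          (fun y y' hy => by simp only [estimate_congr n y y' hy]) fun y => ?_
        rw [abs_pow]
        refine pow_le_pow_left₀ (abs_nonneg _) ((abs_sub _ _).trans ?_) 2
        rw [Nat.abs_cast]
        exact add_le_add_left (abs_estimate_le hδ (fun k hk => hF k (by omega)) y) _
      · exact (h.integrable_inv_freeArea hδ hFn).sub (integrable_const _)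

theorem memLp_estimate [IsProbabilityMeasure μ] (h : IsIIDSequence μ ν Y) {δ : ℝ} (hδ : 0 < δ)
    {n : ℕ} (hF : ∀ k < n, ∀ y : ℕ → Option C, δ ≤ freeArea ν (occupied y k)) :
    MemLp (fun ω => estimate ν (fun i => Y i ω) n) 2 μ :=
  MemLp.of_bound (h.measurable_of_dependsOnFirst (estimate_congr n)).aestronglyMeasurable
    (n * (1 / δ)) (ae_of_all _ fun _ => abs_estimate_le hδ hF _)

theorem variance_estimate [IsProbabilityMeasure μ] (h : IsIIDSequence μ ν Y) {δ : ℝ} (hδ : 0 < δ)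
    {n : ℕ} (hF : ∀ k < n, ∀ y : ℕ → Option C, δ ≤ freeArea ν (occupied y k)) :
    Var[fun ω => estimate ν (fun i => Y i ω) n; μ] =
      ∑ k ∈ Finset.range n, (∫ ω, 1 / freeArea ν (occupied (fun i => Y i ω) k) ∂μ - 1) := by
  obtain ⟨h1, h2⟩ := h.estimate_moments hδ hF
  have hm := h.memLp_estimate hδ hF
  have hmean : ∫ ω, estimate ν (fun i => Y i ω) n ∂μ = n := by
    rw [integral_sub (hm.integrable (by norm_num)) (integrable_const _)] at h1
    simp at h1
    linarith
  rw [variance_eq_integral hm.aestronglyMeasurable.aemeasurable, hmean]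
  exact h2

end IsIIDSequence

/-- If many cells are at least `a` large, few outcomes leave a large free area. -/
theorem freeArea_ge [IsProbabilityMeasure ν] {T : Finset C} {a : ℝ}
    (ha : ∀ c ∈ T, a ≤ ν.real {some c}) (ha0 : 0 ≤ a) {s : Finset C} {r : ℕ}
    (hr : s.card + r ≤ T.card) : r * a ≤ freeArea ν s := by
  rw [freeArea_eq]
  refine le_trans ?_ ((summable_expectedFreeArea 0 s).sum_le_tsum (T \ s) fun c _ => ?_)
  · have hc : r ≤ (T \ s).card := by
      have := Finset.le_card_sdiff s T
      omega
    calc (r : ℝ) * a ≤ (T \ s).card * a := by gcongr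
      _ = (T \ s).card • a := by simp
      _ ≤ _ := Finset.card_nsmul_le_sum _ _ _ fun c hc => by
        rw [Finset.mem_sdiff] at hc
        simpa [hc.2] using ha c hc.1
  · split_ifs
    · rfl
    · simp [measureReal_nonneg]

end Estimator

/-! ### Conditional entropy of a split atom -/

section EntropyFunctions

open Real

/-- The entropy gained by splitting an atom of mass `x + y` into atoms of masses `x` and `y`. -/
noncomputable def splitEntropy (x y : ℝ) : ℝ := negMulLog x + negMulLog y - negMulLog (x + y)

theorem splitEntropy_mul (t p : ℝ) : splitEntropy (t * p) (t * (1 - p)) = t * binEntropy p := by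
  rw [splitEntropy, ← mul_add, add_sub_cancel, mul_one, negMulLog_mul, negMulLog_mul,
    binEntropy_eq_negMulLog_add_negMulLog_one_sub]
  ring

theorem splitEntropy_zero : splitEntropy 0 0 = 0 := by simp [splitEntropy]

theorem splitEntropy_eq {x y : ℝ} (h : 0 < x + y) :
    splitEntropy x y = (x + y) * binEntropy (x / (x + y)) := by
  rw [← splitEntropy_mul]
  congr 1 <;> field_simp
  ring

/-- The function is homogeneous of degree one, and concave because binary entropy is; together these
give superadditivity. It expresses that merging values of the conditioning variable cannot decrease
conditional entropy. -/
theorem splitEntropy_add_le {x y x' y' : ℝ} (hx : 0 ≤ x) (hy : 0 ≤ y) (hx' : 0 ≤ x')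
    (hy' : 0 ≤ y') : splitEntropy x y + splitEntropy x' y' ≤ splitEntropy (x + x') (y + y') := by
  rcases (add_nonneg hx hy).eq_or_lt with h | h
  · obtain ⟨rfl, rfl⟩ : x = 0 ∧ y = 0 := ⟨by linarith, by linarith⟩
    simp [splitEntropy_zero]
  rcases (add_nonneg hx' hy').eq_or_lt with h' | h'
  · obtain ⟨rfl, rfl⟩ : x' = 0 ∧ y' = 0 := ⟨by linarith, by linarith⟩
    simp [splitEntropy_zero]
  have hs : 0 < (x + x') + (y + y') := by linarith
  rw [splitEntropy_eq h, splitEntropy_eq h', splitEntropy_eq hs]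
  have hmem : ∀ {u v : ℝ}, 0 ≤ u → 0 ≤ v → 0 < u + v → u / (u + v) ∈ Set.Icc (0 : ℝ) 1 :=
    fun hu hv huv => ⟨div_nonneg hu huv.le, (div_le_one huv).2 (by linarith)⟩
  have := strictConcave_binEntropy.concaveOn.2 (hmem hx hy h) (hmem hx' hy' h')
    (div_nonneg h.le hs.le) (div_nonneg h'.le hs.le) (by field_simp; ring)
  simp only [smul_eq_mul] at this
  have e : (x + y) / ((x + x') + (y + y')) * (x / (x + y)) +
      (x' + y') / ((x + x') + (y + y')) * (x' / (x' + y')) =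
      (x + x') / ((x + x') + (y + y')) := by
    field_simp
  rw [e] at this
  have h3 := mul_le_mul_of_nonneg_left this hs.le
  refine le_trans (le_of_eq ?_) h3
  field_simp

theorem sum_splitEntropy_le {ι : Type*} (U : Finset ι) {x y : ι → ℝ} (hx : ∀ i ∈ U, 0 ≤ x i)
    (hy : ∀ i ∈ U, 0 ≤ y i) :
    ∑ i ∈ U, splitEntropy (x i) (y i) ≤ splitEntropy (∑ i ∈ U, x i) (∑ i ∈ U, y i) := by
  classical
  induction U using Finset.induction_on with
  | empty => simp [splitEntropy_zero]
  | insert i U hi ih =>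
    rw [Finset.sum_insert hi, Finset.sum_insert hi, Finset.sum_insert hi]
    refine le_trans (add_le_add_right (ih (fun j hj => hx j (Finset.mem_insert_of_mem hj))
      fun j hj => hy j (Finset.mem_insert_of_mem hj)) _) (splitEntropy_add_le
        (hx i (Finset.mem_insert_self _ _)) (hy i (Finset.mem_insert_self _ _))
        (Finset.sum_nonneg fun j hj => hx j (Finset.mem_insert_of_mem hj))
        (Finset.sum_nonneg fun j hj => hy j (Finset.mem_insert_of_mem hj)))

theorem pow_sub_pow_le {x y : ℝ} (hy : 0 ≤ y) (hyx : y ≤ x) (hx : x ≤ 1) (n : ℕ) :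
    x ^ n - y ^ n ≤ n * (x - y) := by
  induction n with
  | zero => simp
  | succ n ih =>
    have h1 : y ^ n ≤ 1 := pow_le_one₀ hy (hyx.trans hx)
    have h2 : y ^ n ≤ x ^ n := pow_le_pow_left₀ hy hyx n
    have h3 : x * (x ^ n - y ^ n) ≤ 1 * (x ^ n - y ^ n) :=
      mul_le_mul_of_nonneg_right hx (by linarith)
    have h4 : y ^ n * (x - y) ≤ 1 * (x - y) := mul_le_mul_of_nonneg_right h1 (by linarith)
    rw [pow_succ, pow_succ]
    push_cast
    nlinarith

/-- A continuous function on the unit interval varies at most quadratically, up to `ε`. -/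
theorem exists_binEntropy_sub_le {ε : ℝ} (hε : 0 < ε) :
    ∃ K : ℝ, 0 ≤ K ∧ ∀ p ∈ Set.Icc (0 : ℝ) 1, ∀ q ∈ Set.Icc (0 : ℝ) 1,
      binEntropy q - binEntropy p ≤ ε + K * (p - q) ^ 2 := by
  have hu := isCompact_Icc.uniformContinuousOn_of_continuous
    (binEntropy_continuous.continuousOn (s := Set.Icc (0 : ℝ) 1))
  obtain ⟨δ, hδ, h⟩ := Metric.uniformContinuousOn_iff.1 hu ε hε
  -- Closer than δ, uniform continuity gives ε. Farther apart, the quadratic term is at least log 2,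
  -- the maximum of the binary entropy.
  refine ⟨log 2 / δ ^ 2, by positivity, fun p hp q hq => ?_⟩
  rcases lt_or_ge (dist q p) δ with hd | hd
  · have := h q hq p hp hd
    have h2 := le_abs_self (binEntropy q - binEntropy p)
    have h3 : 0 ≤ log 2 / δ ^ 2 * (p - q) ^ 2 := by positivity
    rw [Real.dist_eq] at this
    linarith
  · have h1 := binEntropy_le_log_two (p := q)
    have h2 := binEntropy_nonneg hp.1 hp.2
    have h3 : δ ^ 2 ≤ (p - q) ^ 2 := by
      rw [Real.dist_eq, abs_sub_comm] at hd
      rw [← sq_abs (p - q)]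
      exact pow_le_pow_left₀ hδ.le hd 2
    have h4 : log 2 ≤ log 2 / δ ^ 2 * (p - q) ^ 2 := by
      rw [div_mul_eq_mul_div, le_div_iff₀ (by positivity)]
      exact mul_le_mul_of_nonneg_left h3 (log_nonneg (by norm_num))
    linarith

end EntropyFunctions

/-! ### Entropy of random finite sets -/

section Entropy

open Real

variable {Ω C : Type*} [MeasurableSpace Ω] {μ : Measure Ω} [DecidableEq C]

theorem sum_measureReal_fiber [IsFiniteMeasure μ] {β : Type*} {F : Ω → β} {U : Finset β}
    (hU : ∀ ω, F ω ∈ U) (hF : ∀ u ∈ U, MeasurableSet {ω | F ω = u}) (E : Set Ω) :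
    ∑ u ∈ U, μ.real {ω | F ω = u ∧ ω ∈ E} = μ.real E := by
  have h1 : ∀ u ∈ U, μ.real {ω | F ω = u ∧ ω ∈ E} = (μ.restrict E).real {ω | F ω = u} :=
    fun u hu => by
      rw [measureReal_restrict_apply (hF u hu)]
      rfl
  rw [Finset.sum_congr rfl h1, ← measureReal_biUnion_finset _ hF]
  · have : (⋃ u ∈ U, {ω | F ω = u}) = Set.univ := by
      ext ω
      simpa using hU ω
    rw [this, measureReal_restrict_apply MeasurableSet.univ, Set.univ_inter]
  · intro u _ v _ huv
    refine Set.disjoint_left.2 fun ω h1 h2 => huv ?_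
    exact h1.symm.trans h2

/-- The entropy, in nats, of the part of a random set inside `T`. -/
noncomputable def partialEntropy (μ : Measure Ω) (S : Ω → Finset C) (T : Finset C) : ℝ :=
  ∑ s ∈ T.powerset, negMulLog (μ.real {ω | S ω ∩ T = s})

theorem measurableSet_inter_eq {S : Ω → Finset C} (hS : ∀ c, MeasurableSet {ω | c ∈ S ω})
    (T s : Finset C) : MeasurableSet {ω | S ω ∩ T = s} := by
  by_cases h : s ⊆ T
  · have : {ω | S ω ∩ T = s} =
        (⋂ c ∈ s, {ω | c ∈ S ω}) ∩ ⋂ c ∈ T \ s, {ω | c ∈ S ω}ᶜ := by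
      ext ω
      simp only [Set.mem_ofPred_eq, Set.mem_inter_iff, Set.mem_iInter, Finset.mem_sdiff,
        Set.mem_compl_iff, Finset.ext_iff, Finset.mem_inter]
      constructor
      · intro h'
        exact ⟨fun c hc => ((h' c).2 hc).1, fun c hc h2 => hc.2 ((h' c).1 ⟨h2, hc.1⟩)⟩
      · rintro ⟨h1, h2⟩ c
        exact ⟨fun hc => by_contra fun h3 => h2 c ⟨hc.2, h3⟩ hc.1, fun hc => ⟨h1 c hc, h hc⟩⟩
    rw [this]
    exact (Finset.measurableSet_biInter _ fun c _ => hS c).inter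
      (Finset.measurableSet_biInter _ fun c _ => (hS c).compl)
  · convert MeasurableSet.empty
    ext ω
    simp only [Set.mem_ofPred_eq, Set.mem_empty_iff_false, iff_false]
    rintro rfl
    exact h Finset.inter_subset_right

/-- The chain rule: the added sum is the entropy of the event that `c` is in the set, conditional on
the part inside `T`. -/
theorem partialEntropy_insert [IsFiniteMeasure μ] {S : Ω → Finset C}
    (hS : ∀ c, MeasurableSet {ω | c ∈ S ω}) {T : Finset C} {c : C} (hc : c ∉ T) :
    partialEntropy μ S (insert c T) = partialEntropy μ S T +
      ∑ s ∈ T.powerset, splitEntropy (μ.real {ω | S ω ∩ T = s ∧ c ∉ S ω})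
        (μ.real {ω | S ω ∩ T = s ∧ c ∈ S ω}) := by
  rw [partialEntropy, Finset.sum_powerset_insert hc, ← Finset.sum_add_distrib, partialEntropy,
    ← Finset.sum_add_distrib]
  refine Finset.sum_congr rfl fun s hs => ?_
  have hcs : c ∉ s := fun h => hc (Finset.mem_powerset.1 hs h)
  have hsT := Finset.mem_powerset.1 hs
  have e1 : {ω | S ω ∩ insert c T = s} = {ω | S ω ∩ T = s ∧ c ∉ S ω} := by
    ext ω
    simp only [Set.mem_ofPred_eq]
    by_cases h : c ∈ S ω
    · simp only [h, not_true, and_false, iff_false]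
      rintro rfl
      exact hcs (by simp [h])
    · rw [Finset.inter_insert_of_notMem h]
      simp [h]
  have e2 : {ω | S ω ∩ insert c T = insert c s} = {ω | S ω ∩ T = s ∧ c ∈ S ω} := by
    ext ω
    simp only [Set.mem_ofPred_eq]
    by_cases h : c ∈ S ω
    · rw [Finset.inter_insert_of_mem h]
      simp only [h, and_true]
      constructor
      · intro h'
        have := congrArg (fun u => u.erase c) h'
        simpa [Finset.erase_insert_eq_erase, Finset.erase_eq_of_notMem, hcs, hc] using this
      · rintro rfl
        rfl
    · simp only [h, and_false, iff_false]
      intro h'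
      have : c ∈ S ω ∩ insert c T := by rw [h']; simp
      exact h (Finset.mem_inter.1 this).1
  have e3 : μ.real {ω | S ω ∩ T = s} = μ.real {ω | S ω ∩ T = s ∧ c ∉ S ω} +
      μ.real {ω | S ω ∩ T = s ∧ c ∈ S ω} := by
    rw [← measureReal_sdiff_add_inter (s := {ω | S ω ∩ T = s}) (hS c)]
    rfl
  rw [e1, e2, e3, splitEntropy]
  ring

/-- Subadditivity: by the chain rule each new cell adds its conditional entropy, and merging all
conditions bounds this by its own entropy. -/
theorem partialEntropy_le_sum [IsProbabilityMeasure μ] {S : Ω → Finset C}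
    (hS : ∀ c, MeasurableSet {ω | c ∈ S ω}) (T : Finset C) :
    partialEntropy μ S T ≤ ∑ c ∈ T, binEntropy (μ.real {ω | c ∉ S ω}) := by
  induction T using Finset.induction_on with
  | empty => simp [partialEntropy]
  | insert c T hc ih =>
    rw [partialEntropy_insert hS hc, Finset.sum_insert hc, add_comm]
    refine add_le_add ((sum_splitEntropy_le _ (fun _ _ => measureReal_nonneg)
      fun _ _ => measureReal_nonneg).trans_eq ?_) ih
    have hU : ∀ ω, S ω ∩ T ∈ T.powerset := fun ω =>
      Finset.mem_powerset.2 Finset.inter_subset_right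
    have hF := fun u (_ : u ∈ T.powerset) => measurableSet_inter_eq hS T u
    have h1 := sum_measureReal_fiber (μ := μ) hU hF {ω | c ∉ S ω}
    have h2 := sum_measureReal_fiber (μ := μ) hU hF {ω | c ∈ S ω}
    simp only [Set.mem_ofPred_eq] at h1 h2
    rw [h1, h2]
    have h3 := probReal_compl_eq_one_sub (μ := μ) (hS c).compl
    rw [compl_compl] at h3
    change μ.real {ω | c ∈ S ω} = 1 - μ.real {ω | c ∉ S ω} at h3
    have h4 := splitEntropy_mul 1 (μ.real {ω | c ∉ S ω})
    rwa [one_mul, one_mul, one_mul, ← h3] at h4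

/-- Refining the conditioning variable decreases conditional entropy. -/
theorem partialEntropy_add_le_insert [IsProbabilityMeasure μ] {S : Ω → Finset C}
    (hS : ∀ c, MeasurableSet {ω | c ∈ S ω}) {T : Finset C} {c : C} (hc : c ∉ T)
    {β : Type*} {Z : Ω → β} {U : Finset β} (hU : ∀ ω, Z ω ∈ U)
    (hZ : ∀ u ∈ U, MeasurableSet {ω | Z ω = u}) {f : β → Finset C}
    (hf : ∀ ω, f (Z ω) = S ω ∩ T) (hfT : ∀ u ∈ U, f u ⊆ T) :
    partialEntropy μ S T + ∑ z ∈ U, splitEntropy (μ.real {ω | Z ω = z ∧ c ∉ S ω})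
        (μ.real {ω | Z ω = z ∧ c ∈ S ω}) ≤ partialEntropy μ S (insert c T) := by
  rw [partialEntropy_insert hS hc]
  refine add_le_add_right ?_ _
  -- `Z` determines the part inside `T`, so only the summand `s = f z` is nonzero. After exchanging
  -- the sums, all `z` with the same `s` are merged by superadditivity.
  have key : ∀ z ∈ U, splitEntropy (μ.real {ω | Z ω = z ∧ c ∉ S ω})
        (μ.real {ω | Z ω = z ∧ c ∈ S ω}) = ∑ s ∈ T.powerset,
        splitEntropy (μ.real {ω | Z ω = z ∧ S ω ∩ T = s ∧ c ∉ S ω})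
        (μ.real {ω | Z ω = z ∧ S ω ∩ T = s ∧ c ∈ S ω}) := by
    intro z hz
    rw [Finset.sum_eq_single (f z)]
    · have : ∀ P : Ω → Prop, {ω | Z ω = z ∧ S ω ∩ T = f z ∧ P ω} = {ω | Z ω = z ∧ P ω} := by
        intro P
        ext ω
        simp only [Set.mem_ofPred_eq]
        constructor
        · exact fun h => ⟨h.1, h.2.2⟩
        · exact fun h => ⟨h.1, by rw [← hf, h.1], h.2⟩
      rw [this, this]
    · intro s _ hs
      have : ∀ P : Ω → Prop, {ω | Z ω = z ∧ S ω ∩ T = s ∧ P ω} = ∅ := by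
        intro P
        ext ω
        simp only [Set.mem_ofPred_eq, Set.mem_empty_iff_false, iff_false]
        rintro ⟨h1, h2, _⟩
        exact hs (by rw [← h2, ← hf, h1])
      rw [this, this]
      simp [splitEntropy_zero]
    · intro h
      exact absurd (Finset.mem_powerset.2 (hfT z hz)) h
  rw [Finset.sum_congr rfl key, Finset.sum_comm]
  refine Finset.sum_le_sum fun s _ => ?_
  refine (sum_splitEntropy_le U (fun _ _ => measureReal_nonneg)
      fun _ _ => measureReal_nonneg).trans_eq ?_
  have h1 := sum_measureReal_fiber (μ := μ) hU hZ {ω | S ω ∩ T = s ∧ c ∉ S ω}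
  have h2 := sum_measureReal_fiber (μ := μ) hU hZ {ω | S ω ∩ T = s ∧ c ∈ S ω}
  simp only [Set.mem_ofPred_eq] at h1 h2
  rw [h1, h2]

variable [Countable C]

/-- The events `S ω ∩ T = s ∩ T` decrease, as `T` grows, to the event that the set equals `s`; once
`T` contains `s`, the right side is `s` itself. -/
theorem tendsto_measureReal_inter_eq [IsProbabilityMeasure μ] {S : Ω → Finset C}
    (hS : ∀ c, MeasurableSet {ω | c ∈ S ω}) (s : Finset C) :
    Tendsto (fun T => μ.real {ω | S ω ∩ T = s}) atTop (𝓝 (μ.real (S ⁻¹' {s}))) := by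
  have h := tendsto_measure_iInter_atTop (μ := μ) (s := fun T => {ω | S ω ∩ T = s ∩ T})
    (fun T => (measurableSet_inter_eq hS T _).nullMeasurableSet)
    (fun T T' hT ω hω => by
      simp only [Set.mem_ofPred_eq, Finset.ext_iff, Finset.mem_inter] at hω ⊢
      intro c
      have := hω c
      have := @hT c
      tauto) ⟨∅, measure_ne_top _ _⟩
  have e : (⋂ T, {ω | S ω ∩ T = s ∩ T}) = S ⁻¹' {s} := by
    ext ω
    simp only [Set.mem_iInter, Set.mem_ofPred_eq, Set.mem_preimage, Set.mem_singleton_iff]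
    constructor
    · intro h
      have h1 := h (S ω ∪ s)
      simpa [Finset.inter_eq_left.2 Finset.subset_union_left,
        Finset.inter_eq_left.2 Finset.subset_union_right] using h1
    · rintro rfl T
      rfl
  rw [e] at h
  refine ((ENNReal.tendsto_toReal (measure_ne_top _ _)).comp h).congr' ?_
  filter_upwards [eventually_ge_atTop s] with T hT
  simp only [Function.comp_apply, measureReal_def, Finset.inter_eq_left.2 hT]

/-- Finitely many values all lie inside a large finite `T`, where subadditivity applies; continuity
of `negMulLog` passes to the limit in `T`. -/
theorem sum_negMulLog_le [IsProbabilityMeasure μ] {S : Ω → Finset C}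
    (hS : ∀ c, MeasurableSet {ω | c ∈ S ω})
    (hs : Summable fun c => binEntropy (μ.real {ω | c ∉ S ω})) (F : Finset (Finset C)) :
    ∑ s ∈ F, negMulLog (μ.real (S ⁻¹' {s})) ≤ ∑' c, binEntropy (μ.real {ω | c ∉ S ω}) := by
  have hlim : Tendsto (fun T => ∑ s ∈ F, negMulLog (μ.real {ω | S ω ∩ T = s})) atTop
      (𝓝 (∑ s ∈ F, negMulLog (μ.real (S ⁻¹' {s})))) :=
    tendsto_finsetSum _ fun s _ =>
      (continuous_negMulLog.tendsto _).comp (tendsto_measureReal_inter_eq hS s)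
  refine le_of_tendsto hlim ?_
  filter_upwards [eventually_ge_atTop (F.biUnion id)] with T hT
  have hsub : F ⊆ T.powerset := fun s hs => Finset.mem_powerset.2
    ((Finset.subset_biUnion_of_mem id hs).trans hT)
  refine (Finset.sum_le_sum_of_subset_of_nonneg hsub fun s _ _ =>
    negMulLog_nonneg measureReal_nonneg measureReal_le_one).trans
    ((partialEntropy_le_sum hS T).trans (hs.sum_le_tsum _ fun c _ =>
      binEntropy_nonneg measureReal_nonneg measureReal_le_one))

theorem summable_negMulLog [IsProbabilityMeasure μ] {S : Ω → Finset C}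
    (hS : ∀ c, MeasurableSet {ω | c ∈ S ω})
    (hs : Summable fun c => binEntropy (μ.real {ω | c ∉ S ω})) :
    Summable fun s => negMulLog (μ.real (S ⁻¹' {s})) :=
  summable_of_sum_le (fun _ => negMulLog_nonneg measureReal_nonneg measureReal_le_one)
    (sum_negMulLog_le hS hs)

theorem tsum_negMulLog_le [IsProbabilityMeasure μ] {S : Ω → Finset C}
    (hS : ∀ c, MeasurableSet {ω | c ∈ S ω})
    (hs : Summable fun c => binEntropy (μ.real {ω | c ∉ S ω})) :
    ∑' s, negMulLog (μ.real (S ⁻¹' {s})) ≤ ∑' c, binEntropy (μ.real {ω | c ∉ S ω}) :=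
  (summable_negMulLog hS hs).tsum_le_of_sum_le (sum_negMulLog_le hS hs)

theorem measurableSet_preimage_singleton {S : Ω → Finset C}
    (hS : ∀ c, MeasurableSet {ω | c ∈ S ω}) (s : Finset C) : MeasurableSet (S ⁻¹' {s}) := by
  have : S ⁻¹' {s} = ⋂ c, {ω | c ∈ S ω ↔ c ∈ s} := by
    ext ω
    simp [Finset.ext_iff]
  rw [this]
  refine MeasurableSet.iInter fun c => ?_
  by_cases hc : c ∈ s
  · simpa [hc] using hS c
  · simp only [hc, iff_false]
    exact (hS c).compl

theorem hasSum_measureReal_preimage [IsFiniteMeasure μ] {S : Ω → Finset C}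
    (hS : ∀ c, MeasurableSet {ω | c ∈ S ω}) (E : Set Ω) :
    HasSum (fun s => μ.real {ω | S ω = s ∧ ω ∈ E}) (μ.real E) := by
  have h := hasSum_integral_iUnion (μ := μ.restrict E) (f := fun _ => (1 : ℝ))
    (s := fun s => S ⁻¹' {s}) (fun s => measurableSet_preimage_singleton hS s)
    (fun s t hst => Set.disjoint_left.2 fun ω h1 h2 => hst (h1.symm.trans h2))
    (integrable_const _).integrableOn
  have e : (⋃ s, S ⁻¹' {s}) = Set.univ := by
    ext ω
    simp
  rw [e] at h
  convert h using 2 with s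
  · rfl
  · rw [setIntegral_const, smul_eq_mul, mul_one,
      measureReal_restrict_apply (measurableSet_preimage_singleton hS s)]
    rfl
  · simp

/-- Restricting a random set to `T` does not increase its entropy. -/
theorem partialEntropy_le_tsum [IsProbabilityMeasure μ] {S : Ω → Finset C}
    (hS : ∀ c, MeasurableSet {ω | c ∈ S ω})
    (hs : Summable fun s => negMulLog (μ.real (S ⁻¹' {s}))) (T : Finset C) :
    partialEntropy μ S T ≤ ∑' s, negMulLog (μ.real (S ⁻¹' {s})) := by
  have h1 : HasSum (fun s' => ∑ s ∈ T.powerset,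
      μ.real {ω | S ω = s' ∧ ω ∈ {ω | S ω ∩ T = s}} * (-log (μ.real {ω | S ω ∩ T = s})))
      (∑ s ∈ T.powerset, μ.real {ω | S ω ∩ T = s} * (-log (μ.real {ω | S ω ∩ T = s}))) :=
    hasSum_sum fun s _ => (hasSum_measureReal_preimage hS _).mul_right _
  have h2 : partialEntropy μ S T =
      ∑ s ∈ T.powerset, μ.real {ω | S ω ∩ T = s} * (-log (μ.real {ω | S ω ∩ T = s})) :=
    Finset.sum_congr rfl fun s _ => by rw [negMulLog]; ring
  rw [h2]
  -- Termwise comparison: the probability of a value is at most that of its restriction to `T`, so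
  -- its negative logarithm is at least as large.
  refine hasSum_le (fun s' => ?_) h1 hs.hasSum
  rw [Finset.sum_eq_single (s' ∩ T)]
  · have e : {ω | S ω = s' ∧ ω ∈ {ω | S ω ∩ T = s' ∩ T}} = S ⁻¹' {s'} := by
      ext ω
      simp only [Set.mem_ofPred_eq, Set.mem_preimage, Set.mem_singleton_iff, and_iff_left_iff_imp]
      rintro rfl
      rfl
    rw [e, negMulLog, neg_mul, ← mul_neg]
    rcases (measureReal_nonneg (μ := μ) (s := S ⁻¹' {s'})).eq_or_lt with h0 | h0
    · simp [← h0]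
    · refine mul_le_mul_of_nonneg_left (neg_le_neg (log_le_log h0 (measureReal_mono ?_))) h0.le
      rintro ω rfl
      rfl
  · intro s _ hs
    have e : {ω | S ω = s' ∧ ω ∈ {ω | S ω ∩ T = s}} = ∅ := by
      ext ω
      simp only [Set.mem_ofPred_eq, Set.mem_empty_iff_false, iff_false]
      rintro ⟨rfl, h⟩
      exact hs h.symm
    rw [e]
    simp
  · intro h
    exact absurd (Finset.mem_powerset.2 Finset.inter_subset_right) h

end Entropy

/-! ### Lower bound for the entropy of the occupied set -/

section EntropyLowerBound

open Real

variable {Ω C : Type*} [MeasurableSpace Ω] {μ : Measure Ω} {ν : Measure (Option C)}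
  {Y : ℕ → Ω → Option C} [Countable C] [DecidableEq C]

/-- The outcome as seen by an observer of the cells in `T`. -/
def observe (T : Finset C) (o : Option C) : Option C := o.filter (fun c => decide (c ∈ T))

theorem observe_eq_none_iff {T : Finset C} {o : Option C} :
    observe T o = none ↔ ∀ c ∈ T, o ≠ some c := by
  cases o with
  | none => simp [observe]
  | some d =>
    simp only [observe, Option.filter_some]
    by_cases hd : d ∈ T
    · simp [hd]
    · simp only [hd, decide_false, Bool.false_eq_true, if_false, true_iff]
      rintro c hc h
      rw [Option.some_inj] at h
      exact hd (h ▸ hc)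

theorem observe_eq_some_iff {T : Finset C} {o : Option C} {c : C} :
    observe T o = some c ↔ c ∈ T ∧ o = some c := by
  cases o with
  | none => simp [observe]
  | some d =>
    simp only [observe, Option.filter_some]
    by_cases hd : d ∈ T
    · simp only [hd, decide_true, if_true, Option.some_inj]
      exact ⟨fun h => ⟨h ▸ hd, h⟩, fun h => h.2⟩
    · simp only [hd, decide_false, Bool.false_eq_true, if_false, Option.some_inj, false_iff,
        reduceCtorEq]
      rintro ⟨h1, rfl⟩
      exact hd h1

theorem observe_mem_insertNone (T : Finset C) (o : Option C) :
    observe T o ∈ Finset.insertNone T := by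
  rw [Finset.mem_insertNone]
  intro c hc
  exact (observe_eq_some_iff.1 hc).1

theorem measureReal_observe_none [IsProbabilityMeasure ν] (T : Finset C) :
    ν.real {o | observe T o = none} = 1 - ∑ c ∈ T, ν.real {some c} := by
  have h1 : {o : Option C | observe T o = none} = (⋃ c ∈ T, {some c})ᶜ := by
    ext o
    simp [observe_eq_none_iff]
  rw [h1, probReal_compl_eq_one_sub MeasurableSet.of_discrete,
    measureReal_biUnion_finset _ fun _ _ => MeasurableSet.of_discrete]
  intro a _ b _ hab
  simp [Function.onFun, hab]

theorem measureReal_observe_some {T : Finset C} {c : C} (hc : c ∈ T) :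
    ν.real {o | observe T o = some c} = ν.real {some c} := by
  congr 1
  ext o
  simp [observe_eq_some_iff, hc]

/-- A dart that hits `T` certainly avoids `c`. One that misses `T`, which has probability 1 - A,
avoids `c` with conditional probability (1 - A - a)/(1 - A). -/
theorem measureReal_observe_and_ne [IsProbabilityMeasure ν] {T : Finset C} {c : C} (hc : c ∉ T)
    (hT : ∑ d ∈ T, ν.real {some d} < 1) {o : Option C} (ho : o ∈ Finset.insertNone T) :
    ν.real {o' | observe T o' = o ∧ o' ≠ some c} = ν.real {o' | observe T o' = o} *
      o.elim ((1 - ∑ d ∈ T, ν.real {some d} - ν.real {some c}) /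
        (1 - ∑ d ∈ T, ν.real {some d})) (fun _ => 1) := by
  cases o with
  | none =>
    have e : {o' : Option C | observe T o' = none ∧ o' ≠ some c} =
        {o' | observe (insert c T) o' = none} := by
      ext o'
      simp only [observe_eq_none_iff, Set.mem_ofPred_eq, Finset.mem_insert, forall_eq_or_imp]
      tauto
    rw [e, measureReal_observe_none, measureReal_observe_none, Finset.sum_insert hc,
      Option.elim_none, mul_div_cancel₀ _ (by linarith)]
    ring
  | some d =>
    have hd : d ∈ T := Finset.mem_insertNone.1 ho d rfl
    rw [Option.elim_some, mul_one]
    congr 1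
    ext o'
    simp only [observe_eq_some_iff, Set.mem_ofPred_eq, and_iff_left_iff_imp]
    rintro ⟨_, rfl⟩ h
    rw [Option.some_inj] at h
    exact hc (h ▸ hd)

theorem sum_piFinset_prod {ι : Type*} [DecidableEq ι] (n : ℕ) (T : Finset ι) (g : ι → ℝ) :
    ∑ z ∈ Fintype.piFinset (fun _ : Fin n => T), ∏ i, g (z i) = (∑ o ∈ T, g o) ^ n := by
  have := (Finset.prod_univ_sum (fun _ : Fin n => T) (fun _ o => g o)).symm
  simpa using this

namespace IsIIDSequence

theorem measurableSet_mem_occupied (h : IsIIDSequence μ ν Y) (n : ℕ) (c : C) :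
    MeasurableSet {ω | c ∈ occupied (fun i => Y i ω) n} := by
  have : {ω | c ∈ occupied (fun i => Y i ω) n} = ⋃ i ∈ Finset.range n, Y i ⁻¹' {some c} := by
    ext ω
    simp [mem_occupied]
  rw [this]
  exact Finset.measurableSet_biUnion _ fun i _ => h.measurable i MeasurableSet.of_discrete

theorem measureReal_notMem_occupied [IsProbabilityMeasure μ] (h : IsIIDSequence μ ν Y) (n : ℕ)
    (c : C) : μ.real {ω | c ∉ occupied (fun i => Y i ω) n} = (1 - ν.real {some c}) ^ n := by
  have := h.isProbabilityMeasure_law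
  have e := h.measureReal_forall_mem n (fun _ => {some c}ᶜ)
  rw [Finset.prod_const, Finset.card_range,
    probReal_compl_eq_one_sub MeasurableSet.of_discrete] at e
  rw [← e]
  congr 1
  ext ω
  simp [mem_occupied]

theorem measureReal_observe_eq [IsProbabilityMeasure μ] (h : IsIIDSequence μ ν Y) {n : ℕ}
    (T : Finset C) (z : Fin n → Option C) :
    μ.real {ω | (fun i : Fin n => observe T (Y i ω)) = z} =
      ∏ i, ν.real {o | observe T o = z i} := by
  have e := h.measureReal_forall_mem n (fun i => {o | ∀ hi : i < n, observe T o = z ⟨i, hi⟩})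
  rw [Finset.prod_range] at e
  simp only [Fin.is_lt, forall_true_left, Fin.eta] at e
  rw [← e]
  congr 1
  ext ω
  simp only [Set.mem_ofPred_eq, funext_iff]
  exact ⟨fun h i hi _ => h ⟨i, hi⟩, fun h i => h i i.2 i.2⟩

theorem measureReal_observe_eq_and_notMem [IsProbabilityMeasure μ] (h : IsIIDSequence μ ν Y)
    {n : ℕ} (T : Finset C) (z : Fin n → Option C) (c : C) :
    μ.real {ω | (fun i : Fin n => observe T (Y i ω)) = z ∧ c ∉ occupied (fun i => Y i ω) n} =
      ∏ i, ν.real {o | observe T o = z i ∧ o ≠ some c} := by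
  have e := h.measureReal_forall_mem n
    (fun i => {o | (∀ hi : i < n, observe T o = z ⟨i, hi⟩) ∧ o ≠ some c})
  rw [Finset.prod_range] at e
  simp only [Fin.is_lt, forall_true_left, Fin.eta] at e
  rw [← e]
  congr 1
  ext ω
  simp only [Set.mem_ofPred_eq, funext_iff, mem_occupied, not_exists, not_and]
  exact ⟨fun h i hi => ⟨fun _ => h.1 ⟨i, hi⟩, h.2 i hi⟩,
    fun h => ⟨fun i => (h i i.2).1 i.2, fun i hi => (h i hi).2⟩⟩

/-- The entropy that a new cell adds is almost that of an independent cell. -/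
theorem partialEntropy_insert_ge [IsProbabilityMeasure μ] (h : IsIIDSequence μ ν Y) (n : ℕ)
    {T : Finset C} {c : C} (hc : c ∉ T) (hT : ∑ d ∈ T, ν.real {some d} < 1) {ε K : ℝ}
    (hK0 : 0 ≤ K) (hK : ∀ p ∈ Set.Icc (0 : ℝ) 1, ∀ q ∈ Set.Icc (0 : ℝ) 1,
      binEntropy q - binEntropy p ≤ ε + K * (p - q) ^ 2) :
    partialEntropy μ (fun ω => occupied (fun i => Y i ω) n) T +
      (binEntropy ((1 - ν.real {some c}) ^ n) - ε -
        K * (n * (ν.real {some c} ^ 2 / (1 - ∑ d ∈ T, ν.real {some d})))) ≤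
    partialEntropy μ (fun ω => occupied (fun i => Y i ω) n) (insert c T) := by
  have := h.isProbabilityMeasure_law
  set S : Ω → Finset C := fun ω => occupied (fun i => Y i ω) n
  set Z : Ω → Fin n → Option C := fun ω i => observe T (Y i ω)
  set U : Finset (Fin n → Option C) := Fintype.piFinset fun _ => Finset.insertNone T
  have hS : ∀ c, MeasurableSet {ω | c ∈ S ω} := h.measurableSet_mem_occupied n
  have hU : ∀ ω, Z ω ∈ U := fun ω => Fintype.mem_piFinset.2 fun i => observe_mem_insertNone T _
  have hZm : Measurable Z := measurable_pi_lambda _ fun i =>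
    (measurable_of_countable _).comp (h.measurable i)
  have hZ : ∀ u ∈ U, MeasurableSet {ω | Z ω = u} := fun u _ =>
    hZm (measurableSet_singleton u)
  -- Condition on the sequence of observed hits, which is finer than the occupied part of `T` but
  -- has a product law.
  refine le_trans (add_le_add_right ?_ _) (partialEntropy_add_le_insert hS hc hU hZ
    (f := fun z => Finset.univ.biUnion fun i => (z i).toFinset) (fun ω => ?_) (fun u hu => ?_))
  rotate_left
  · ext d
    simp only [Finset.mem_biUnion, Finset.mem_univ, true_and, Option.mem_toFinset, Option.mem_def,
      Finset.mem_inter, S, Z, mem_occupied, observe_eq_some_iff]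
    constructor
    · rintro ⟨i, h1, h2⟩
      exact ⟨⟨i, i.2, h2⟩, h1⟩
    · rintro ⟨⟨i, hi, h2⟩, h1⟩
      exact ⟨⟨i, hi⟩, h1, h2⟩
  · intro d hd
    simp only [Finset.mem_biUnion, Finset.mem_univ, true_and, Option.mem_toFinset] at hd
    obtain ⟨i, hi⟩ := hd
    exact Finset.mem_insertNone.1 (Fintype.mem_piFinset.1 hu i) d hi
  set a := ν.real {some c}
  set A := ∑ d ∈ T, ν.real {some d}
  have ha0 : 0 ≤ a := measureReal_nonneg
  have hA0 : 0 ≤ A := Finset.sum_nonneg fun _ _ => measureReal_nonneg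
  have haA : a + A ≤ 1 := by
    have h1 := measureReal_observe_none (ν := ν) (insert c T)
    rw [Finset.sum_insert hc] at h1
    have h2 := measureReal_nonneg (μ := ν) (s := {o | observe (insert c T) o = none})
    linarith
  have hA1 : 0 < 1 - A := by linarith
  set w : Option C → ℝ := fun o => ν.real {o' | observe T o' = o}
  set ρ := (1 - A - a) / (1 - A)
  have hρ0 : 0 ≤ ρ := div_nonneg (by linarith) hA1.le
  have hρ1 : ρ ≤ 1 := (div_le_one hA1).2 (by linarith)
  have hρ : (1 - A) * ρ = 1 - A - a := mul_div_cancel₀ _ hA1.ne'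
  set r : Option C → ℝ := fun o => o.elim ρ (fun _ => 1)
  have hr0 : ∀ o, 0 ≤ r o := by rintro (_ | _) <;> simp [r, hρ0]
  have hr1 : ∀ o, r o ≤ 1 := by rintro (_ | _) <;> simp [r, hρ1]
  have hw0 : ∀ o, 0 ≤ w o := fun o => measureReal_nonneg
  have hsum : ∀ g : Option C → ℝ, (∀ d, g (some d) = 1) →
      ∑ o ∈ Finset.insertNone T, w o * g o = (1 - A) * g none + A := by
    intro g hg
    rw [Finset.sum_insertNone]
    congr 1
    · simp only [w, measureReal_observe_none, A]
    · refine Finset.sum_congr rfl fun d hd => ?_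
      simp only [w, measureReal_observe_some hd, hg, mul_one]
  -- `t z` is the probability of the record `z`, and `p z` the conditional probability that `c` is
  -- free: a factor `ρ` for each dart that misses `T`. Below, `q` is the unconditional probability,
  -- so `s1` says that `p` has mean `q`.
  set t : (Fin n → Option C) → ℝ := fun z => ∏ i, w (z i)
  set p : (Fin n → Option C) → ℝ := fun z => ∏ i, r (z i)
  have ht0 : ∀ z, 0 ≤ t z := fun z => Finset.prod_nonneg fun i _ => hw0 _
  have hp : ∀ z, p z ∈ Set.Icc (0 : ℝ) 1 := fun z =>
    ⟨Finset.prod_nonneg fun i _ => hr0 _, Finset.prod_le_one (fun i _ => hr0 _) fun i _ => hr1 _⟩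
  set q := (1 - a) ^ n
  have hq : q ∈ Set.Icc (0 : ℝ) 1 := ⟨pow_nonneg (by linarith) _, pow_le_one₀ (by linarith)
    (by linarith)⟩
  have hsplit : ∀ z ∈ U, splitEntropy (μ.real {ω | Z ω = z ∧ c ∉ S ω})
      (μ.real {ω | Z ω = z ∧ c ∈ S ω}) = t z * binEntropy (p z) := by
    intro z hz
    have h1 : μ.real {ω | Z ω = z} = t z := h.measureReal_observe_eq T z
    have h2 : μ.real {ω | Z ω = z ∧ c ∉ S ω} = t z * p z := by
      refine (h.measureReal_observe_eq_and_notMem T z c).trans ?_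
      simp only [t, p]
      rw [← Finset.prod_mul_distrib]
      exact Finset.prod_congr rfl fun i _ =>
        measureReal_observe_and_ne hc hT (Fintype.mem_piFinset.1 hz i)
    have h3 : μ.real {ω | Z ω = z} = μ.real {ω | Z ω = z ∧ c ∉ S ω} +
        μ.real {ω | Z ω = z ∧ c ∈ S ω} := by
      rw [← measureReal_sdiff_add_inter (s := {ω | Z ω = z}) (hS c)]
      rfl
    have h4 : μ.real {ω | Z ω = z ∧ c ∈ S ω} = t z * (1 - p z) := by
      rw [h1, h2] at h3
      linarith
    rw [h2, h4, splitEntropy_mul]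
  rw [Finset.sum_congr rfl hsplit]
  have s0 : ∑ z ∈ U, t z = 1 := by
    have := sum_piFinset_prod n (Finset.insertNone T) w
    have h2 := hsum (fun _ => 1) fun _ => rfl
    simp only [mul_one] at h2
    rw [this, h2, sub_add_cancel, one_pow]
  have s1 : ∑ z ∈ U, t z * p z = q := by
    have := sum_piFinset_prod n (Finset.insertNone T) fun o => w o * r o
    simp only [Finset.prod_mul_distrib] at this
    rw [this, hsum r fun _ => rfl]
    simp only [q, r, Option.elim_none, hρ]
    congr 1
    ring
  have s2 : ∑ z ∈ U, t z * p z ^ 2 = ((1 - A) * ρ ^ 2 + A) ^ n := by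
    have := sum_piFinset_prod n (Finset.insertNone T) fun o => w o * r o ^ 2
    simp only [Finset.prod_mul_distrib, Finset.prod_pow] at this
    rw [this, hsum (fun o => r o ^ 2) fun _ => by simp [r]]
    simp only [r, Option.elim_none]
  -- The variance of `p` under the weights `t`. The two bases differ by a²A/(1 - A), and an n-th
  -- power is n-Lipschitz on [0, 1].
  have s3 : ((1 - A) * ρ ^ 2 + A) ^ n - q ^ 2 ≤ n * (a ^ 2 / (1 - A)) := by
    have e : (1 - A) * ρ ^ 2 + A = (1 - a) ^ 2 + a ^ 2 * A / (1 - A) := by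
      simp only [ρ]
      field_simp
      ring
    have e2 : q ^ 2 = ((1 - a) ^ 2) ^ n := by
      simp only [q]
      rw [← pow_mul, ← pow_mul, mul_comm]
    have e3 : 0 ≤ a ^ 2 * A / (1 - A) := by positivity
    have e4 : (1 - A) * ρ ^ 2 + A ≤ 1 := by
      have : ρ ^ 2 ≤ 1 := pow_le_one₀ hρ0 hρ1
      nlinarith
    rw [e2]
    refine (pow_sub_pow_le (sq_nonneg _) (by rw [e]; linarith) e4 n).trans ?_
    refine mul_le_mul_of_nonneg_left ?_ n.cast_nonneg
    rw [e, add_sub_cancel_left]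
    gcongr
    nlinarith [sq_nonneg a]
  calc binEntropy q - ε - K * (n * (a ^ 2 / (1 - A)))
      ≤ binEntropy q - ε - K * (∑ z ∈ U, t z * (p z - q) ^ 2) := by
        have : ∑ z ∈ U, t z * (p z - q) ^ 2 = ((1 - A) * ρ ^ 2 + A) ^ n - q ^ 2 := by
          have e : ∀ z, t z * (p z - q) ^ 2 = t z * p z ^ 2 - (2 * q) * (t z * p z) +
            q ^ 2 * t z := fun z => by ring
          simp_rw [e]
          rw [Finset.sum_add_distrib, Finset.sum_sub_distrib, ← Finset.mul_sum, ← Finset.mul_sum,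
            s0, s1, s2]
          ring
        rw [this]
        linarith [mul_le_mul_of_nonneg_left s3 hK0]
    _ = ∑ z ∈ U, t z * (binEntropy q - ε - K * (p z - q) ^ 2) := by
        have e : ∀ z, t z * (binEntropy q - ε - K * (p z - q) ^ 2) =
            (binEntropy q - ε) * t z - K * (t z * (p z - q) ^ 2) := fun z => by ring
        simp_rw [e]
        rw [Finset.sum_sub_distrib, ← Finset.mul_sum, ← Finset.mul_sum, s0, mul_one]
    _ ≤ _ := Finset.sum_le_sum fun z _ =>
        mul_le_mul_of_nonneg_left (by linarith [hK (p z) (hp z) q hq]) (ht0 z)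

/-- The cells are inserted one by one; the bound `B` on the total area makes all the error terms
uniform. -/
theorem sum_sub_le_partialEntropy [IsProbabilityMeasure μ] (h : IsIIDSequence μ ν Y) (n : ℕ)
    {B : ℝ} (hB : B < 1) {ε K : ℝ}
    (hK0 : 0 ≤ K) (hK : ∀ p ∈ Set.Icc (0 : ℝ) 1, ∀ q ∈ Set.Icc (0 : ℝ) 1,
      binEntropy q - binEntropy p ≤ ε + K * (p - q) ^ 2)
    (T : Finset C) (hT : ∑ d ∈ T, ν.real {some d} ≤ B) :
    ∑ c ∈ T, (binEntropy ((1 - ν.real {some c}) ^ n) - ε -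
        K * (n * (ν.real {some c} ^ 2 / (1 - B)))) ≤
      partialEntropy μ (fun ω => occupied (fun i => Y i ω) n) T := by
  induction T using Finset.induction_on with
  | empty =>
    have h0 : {ω | occupied (fun i => Y i ω) n ∩ ∅ = (∅ : Finset C)} = Set.univ := by
      ext ω
      simp
    simp [partialEntropy]
  | insert c T hc ih =>
    rw [Finset.sum_insert hc] at hT
    have hTB : ∑ d ∈ T, ν.real {some d} ≤ B :=
      le_trans (le_add_of_nonneg_left measureReal_nonneg) hT
    refine le_trans ?_ (h.partialEntropy_insert_ge n hc (hTB.trans_lt hB) hK0 hK)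
    rw [Finset.sum_insert hc, add_comm]
    refine add_le_add (ih hTB) ?_
    gcongr

end IsIIDSequence

end EntropyLowerBound

/-! ### Riemann sums as integrals of step functions -/

section RiemannSums

open Set

theorem iUnion_Ico_div {m : ℕ} (hm : 0 < m) :
    ⋃ k : ℕ, Ico ((k : ℝ) / m) (((k : ℝ) + 1) / m) = Ici 0 := by
  have hm' : (0 : ℝ) < m := by exact_mod_cast hm
  ext x
  simp only [mem_iUnion, mem_Ico, mem_Ici]
  constructor
  · rintro ⟨k, h1, _⟩
    exact le_trans (by positivity) h1
  · intro hx
    refine ⟨⌊m * x⌋₊, ?_, ?_⟩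
    · rw [div_le_iff₀ hm', mul_comm]
      exact Nat.floor_le (by positivity)
    · rw [lt_div_iff₀ hm', mul_comm]
      exact Nat.lt_floor_add_one _

theorem floor_mul_eq {m k : ℕ} (hm : 0 < m) {x : ℝ}
    (hx : x ∈ Ico ((k : ℝ) / m) (((k : ℝ) + 1) / m)) : ⌊(m : ℝ) * x⌋₊ = k := by
  have hm' : (0 : ℝ) < m := by exact_mod_cast hm
  have h1 := (div_le_iff₀ hm').1 hx.1
  have h2 := (lt_div_iff₀ hm').1 hx.2
  rw [mul_comm] at h1 h2
  exact (Nat.floor_eq_iff (le_trans (by positivity) h1)).2 ⟨h1, h2⟩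

/-- The step function takes the value `f k` on an interval of length 1/m, so infinite Riemann sums
become integrals and dominated convergence is available. -/
theorem hasSum_div_of_integrableOn {m : ℕ} (hm : 0 < m) {f : ℕ → ℝ}
    (hf : IntegrableOn (fun x : ℝ => f ⌊m * x⌋₊) (Ioi 0)) :
    HasSum (fun k => f k / m) (∫ x in Ioi (0 : ℝ), f ⌊m * x⌋₊) := by
  have hm' : (0 : ℝ) < m := by exact_mod_cast hm
  rw [← integrableOn_Ici_iff_integrableOn_Ioi, ← iUnion_Ico_div hm] at hf
  rw [← integral_Ici_eq_integral_Ioi, ← iUnion_Ico_div hm]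
  have h := hasSum_integral_iUnion (fun k : ℕ => measurableSet_Ico)
    (fun k l hkl => Set.disjoint_left.2 fun x h1 h2 => hkl (by
      rw [← floor_mul_eq hm h1, ← floor_mul_eq hm h2])) hf
  convert h using 2 with k
  · rfl
  · rw [setIntegral_congr_fun measurableSet_Ico (g := fun _ => f k)
      fun x hx => by simp only [floor_mul_eq hm hx]]
    rw [setIntegral_const, smul_eq_mul, measureReal_def, Real.volume_Ico,
      ENNReal.toReal_ofReal (by rw [← sub_div]; simp), ← sub_div]
    field_simp
    ring

theorem measurable_comp_floor (m : ℕ) (f : ℕ → ℝ) : Measurable fun x : ℝ => f ⌊m * x⌋₊ :=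
  (measurable_of_countable f).comp (Nat.measurable_floor.comp (measurable_const.mul measurable_id))

theorem hasSum_div_of_le {m : ℕ} (hm : 0 < m) {f : ℕ → ℝ} {G : ℝ → ℝ}
    (hG : IntegrableOn G (Ioi 0)) (hle : ∀ x > 0, |f ⌊(m : ℝ) * x⌋₊| ≤ G x) :
    HasSum (fun k => f k / m) (∫ x in Ioi (0 : ℝ), f ⌊m * x⌋₊) :=
  hasSum_div_of_integrableOn hm (Integrable.mono' hG (measurable_comp_floor m f).aestronglyMeasurable
    ((ae_restrict_iff' measurableSet_Ioi).2 (ae_of_all _ fun x hx => hle x hx)))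

/-- Dominated convergence for Riemann sums. -/
theorem tendsto_tsum_div {f : ℕ → ℕ → ℝ} {F G : ℝ → ℝ} (hG : IntegrableOn G (Ioi 0))
    (hle : ∀ m : ℕ, 0 < m → ∀ x > 0, |f m ⌊(m : ℝ) * x⌋₊| ≤ G x)
    (hlim : ∀ᵐ x ∂(volume.restrict (Ioi (0 : ℝ))),
      Tendsto (fun m : ℕ => f m ⌊(m : ℝ) * x⌋₊) atTop (𝓝 (F x))) :
    Tendsto (fun m : ℕ => ∑' k, f m k / m) atTop (𝓝 (∫ x in Ioi (0 : ℝ), F x)) := by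
  have h := tendsto_integral_filter_of_dominated_convergence (l := atTop)
    (F := fun (m : ℕ) x => f m ⌊(m : ℝ) * x⌋₊) (f := F) (μ := volume.restrict (Ioi (0 : ℝ))) G
    (Eventually.of_forall fun m => (measurable_comp_floor m (f m)).aestronglyMeasurable)
    ((eventually_gt_atTop 0).mono fun m hm =>
      (ae_restrict_iff' measurableSet_Ioi).2 (ae_of_all _ fun x hx => hle m hm x hx)) hG hlim
  refine h.congr' ((eventually_gt_atTop 0).mono fun m hm => ?_)
  exact (hasSum_div_of_le hm hG (hle m hm)).tsum_eq.symm

/-- Dominated convergence for Riemann sums on a bounded interval. -/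
theorem tendsto_sum_range_div {f : ℕ → ℕ → ℝ} {F : ℝ → ℝ} {B : ℝ} (J : ℕ)
    (hle : ∀ m k : ℕ, 0 < m → k < J * m → |f m k| ≤ B)
    (hlim : ∀ x : ℝ, 0 < x → x < J →
      Tendsto (fun m : ℕ => f m ⌊(m : ℝ) * x⌋₊) atTop (𝓝 (F x))) :
    Tendsto (fun m : ℕ => ∑ k ∈ Finset.range (J * m), f m k / m) atTop
      (𝓝 (∫ x in (0 : ℝ)..J, F x)) := by
  have hfloor : ∀ (m : ℕ) (x : ℝ), 0 < m → 0 < x → (⌊(m : ℝ) * x⌋₊ < J * m ↔ x < J) := by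
    intro m x hm hx
    have hm' : (0 : ℝ) < m := by exact_mod_cast hm
    rw [Nat.floor_lt (by positivity)]
    push_cast
    rw [mul_comm (J : ℝ), mul_lt_mul_iff_right₀ hm']
  -- The bounded case is the unbounded one with `f` cut off at `J * m`; the cutoff matches x < J
  -- exactly, by `hfloor`.
  have h := tendsto_tsum_div (f := fun m k => if k < J * m then f m k else 0)
    (F := (Iio (J : ℝ)).indicator F) (G := (Iio (J : ℝ)).indicator fun _ => B) ?_ ?_ ?_
  · have e1 : ∫ x in Ioi (0 : ℝ), (Iio (J : ℝ)).indicator F x = ∫ x in (0 : ℝ)..J, F x := by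
      rw [setIntegral_indicator measurableSet_Iio, Ioi_inter_Iio,
        intervalIntegral.integral_of_le J.cast_nonneg, integral_Ioc_eq_integral_Ioo]
    rw [← e1]
    refine h.congr fun m => ?_
    rw [tsum_eq_sum (s := Finset.range (J * m))]
    · exact Finset.sum_congr rfl fun k hk => by rw [if_pos (Finset.mem_range.1 hk)]
    · intro k hk
      rw [Finset.mem_range] at hk
      simp [hk]
  · rw [IntegrableOn, integrable_indicator_iff measurableSet_Iio, IntegrableOn,
      Measure.restrict_restrict measurableSet_Iio, Iio_inter_Ioi]
    exact integrableOn_const (by simp)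
  · intro m hm x hx
    by_cases hxJ : x < J
    · have := (hfloor m x hm hx).2 hxJ
      simpa [this, indicator, hxJ] using hle m _ hm this
    · have := mt (hfloor m x hm hx).1 hxJ
      simp [this, indicator, hxJ]
  · refine (ae_restrict_iff' measurableSet_Ioi).2 (ae_of_all _ fun x hx => ?_)
    by_cases hxJ : x < J
    · rw [indicator_of_mem (by exact hxJ)]
      refine (hlim x hx hxJ).congr' ((eventually_gt_atTop 0).mono fun m hm => ?_)
      simp [(hfloor m x hm hx).2 hxJ]
    · rw [indicator_of_notMem (by exact hxJ)]
      refine tendsto_const_nhds.congr' ((eventually_gt_atTop 0).mono fun m hm => ?_)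
      simp [mt (hfloor m x hm hx).1 hxJ]

end RiemannSums

/-! ### Cell areas and the limiting free area -/

section CellAreas

open Real

/-- The constant `1 - 1/e`, the total area of the cells in the limit of many columns. -/
noncomputable def limitArea : ℝ := 1 - exp (-1)

theorem limitArea_pos : 0 < limitArea := by
  have : exp (-1) < 1 := exp_lt_one_iff.2 (by norm_num)
  rw [limitArea]
  linarith

theorem limitArea_lt_one : limitArea < 1 := by
  rw [limitArea]
  linarith [exp_pos (-1)]

/-- The area of the `k`-th largest cell of the sketch with `m` columns. -/
noncomputable def cellArea (m k : ℕ) : ℝ := limitArea * exp (-(k / m)) / m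

theorem cellArea_nonneg (m k : ℕ) : 0 ≤ cellArea m k := by
  have := limitArea_pos
  rw [cellArea]
  positivity

theorem mul_cellArea {m : ℕ} (hm : 0 < m) (k : ℕ) :
    m * cellArea m k = limitArea * exp (-(k / m)) := by
  have : (m : ℝ) ≠ 0 := by exact_mod_cast hm.ne'
  rw [cellArea]
  field_simp

theorem cellArea_le (m k : ℕ) : cellArea m k ≤ 1 / m := by
  rw [cellArea]
  have h1 : exp (-((k : ℝ) / m)) ≤ 1 := exp_le_one_iff.2 (by
    rw [neg_nonpos]
    positivity)
  have h2 := limitArea_lt_one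
  have h3 := limitArea_pos
  gcongr
  nlinarith [exp_pos (-((k : ℝ) / m))]

theorem cellArea_le_one (m k : ℕ) : cellArea m k ≤ 1 := by
  refine (cellArea_le m k).trans ?_
  rcases Nat.eq_zero_or_pos m with rfl | hm
  · simp
  · rw [div_le_one (by exact_mod_cast hm)]
    exact_mod_cast hm

theorem exp_neg_floor_le {m : ℕ} (hm : 0 < m) (x : ℝ) :
    exp (-((⌊(m : ℝ) * x⌋₊ : ℝ) / m)) ≤ exp (1 - x) := by
  have hm' : (0 : ℝ) < m := by exact_mod_cast hm
  have h1 : (1 : ℝ) ≤ m := by exact_mod_cast hm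
  rw [exp_le_exp]
  have h2 := Nat.lt_floor_add_one ((m : ℝ) * x)
  have h3 : x ≤ ((⌊(m : ℝ) * x⌋₊ : ℝ) + 1) / m := by
    rw [le_div_iff₀ hm', mul_comm]
    exact h2.le
  have h4 : (1 : ℝ) / m ≤ 1 := (div_le_one hm').2 h1
  rw [add_div] at h3
  linarith

/-- The integrable majorant for all area sums: rounding x down to a multiple of 1/m costs at most a
factor e. -/
theorem mul_cellArea_floor_le {m : ℕ} (hm : 0 < m) (x : ℝ) :
    m * cellArea m ⌊(m : ℝ) * x⌋₊ ≤ exp (1 - x) := by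
  rw [mul_cellArea hm]
  refine (mul_le_of_le_one_left (exp_pos _).le limitArea_lt_one.le).trans (exp_neg_floor_le hm x)

theorem tendsto_mul_cellArea {x : ℝ} (hx : 0 ≤ x) :
    Tendsto (fun m : ℕ => m * cellArea m ⌊(m : ℝ) * x⌋₊) atTop (𝓝 (limitArea * exp (-x))) := by
  have h1 : Tendsto (fun m : ℕ => (⌊(m : ℝ) * x⌋₊ : ℝ) / m) atTop (𝓝 x) := by
    have := (tendsto_nat_floor_mul_div_atTop hx).comp (tendsto_natCast_atTop_atTop (R := ℝ))
    refine this.congr fun m => ?_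
    simp [mul_comm]
  have h2 := ((continuous_exp.tendsto _).comp h1.neg).const_mul limitArea
  refine h2.congr' ((eventually_gt_atTop 0).mono fun m hm => ?_)
  simp [mul_cellArea hm]

theorem tendsto_one_sub_pow {a : ℕ → ℝ} {n : ℕ → ℕ} {l t : ℝ} (ha1 : ∀ m, a m ≤ 1)
    (ha : Tendsto (fun m => m * a m) atTop (𝓝 l))
    (hn : Tendsto (fun m => (n m : ℝ) / m) atTop (𝓝 t)) :
    Tendsto (fun m => (1 - a m) ^ n m) atTop (𝓝 (exp (-(t * l)))) := by
  have h1 : Tendsto (fun m => (1 - a m) ^ m) atTop (𝓝 (exp (-l))) := by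
    have := tendsto_one_add_pow_exp_of_tendsto (g := fun m => -a m) (t := -l) (by
      simpa using ha.neg)
    simpa [sub_eq_add_neg] using this
  have h2 := h1.rpow hn (Or.inl (exp_pos _).ne')
  rw [← exp_mul, neg_mul, mul_comm] at h2
  refine h2.congr' ((eventually_gt_atTop 0).mono fun m hm => ?_)
  have hm' : (m : ℝ) ≠ 0 := by exact_mod_cast hm.ne'
  have h3 : 0 ≤ 1 - a m := sub_nonneg.2 (ha1 m)
  rw [← rpow_natCast, ← rpow_mul h3, mul_div_cancel₀ _ hm', rpow_natCast]

theorem integrableOn_exp_sub (b : ℝ) : IntegrableOn (fun x => exp (b - x)) (Set.Ioi 0) := by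
  have := (integrableOn_exp_neg_Ioi 0).const_mul (exp b)
  refine this.congr (ae_of_all _ fun x => ?_)
  simp only
  rw [← exp_add, sub_eq_add_neg]

/-- The limiting free area after `t m` darts. -/
noncomputable def limitFreeArea (t : ℝ) : ℝ :=
  ∫ x in Set.Ioi (0 : ℝ), limitArea * exp (-x) * exp (-(t * (limitArea * exp (-x))))

theorem abs_mul_cellArea_mul_pow_le {m : ℕ} (hm : 0 < m) (n : ℕ) (x : ℝ) :
    |m * cellArea m ⌊(m : ℝ) * x⌋₊ * (1 - cellArea m ⌊(m : ℝ) * x⌋₊) ^ n| ≤ exp (1 - x) := by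
  have h0 := cellArea_nonneg m ⌊(m : ℝ) * x⌋₊
  have h1 := sub_nonneg.2 (cellArea_le_one m ⌊(m : ℝ) * x⌋₊)
  rw [abs_of_nonneg (by positivity)]
  refine (mul_le_of_le_one_right (by positivity) (pow_le_one₀ h1 (by linarith))).trans
    (mul_cellArea_floor_le hm x)

theorem tendsto_tsum_cellArea_mul_pow {n : ℕ → ℕ} {t : ℝ}
    (hn : Tendsto (fun m => (n m : ℝ) / m) atTop (𝓝 t)) :
    Tendsto (fun m => ∑' k, cellArea m k * (1 - cellArea m k) ^ n m) atTop
      (𝓝 (limitFreeArea t)) := by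
  have h := tendsto_tsum_div (f := fun m k => m * cellArea m k * (1 - cellArea m k) ^ n m)
    (F := fun x => limitArea * exp (-x) * exp (-(t * (limitArea * exp (-x)))))
    (integrableOn_exp_sub 1) (fun m hm x _ => abs_mul_cellArea_mul_pow_le hm _ x)
    ((ae_restrict_iff' measurableSet_Ioi).2 (ae_of_all _ fun x hx =>
      (tendsto_mul_cellArea (le_of_lt hx)).mul
        (tendsto_one_sub_pow (fun m => cellArea_le_one _ _) (tendsto_mul_cellArea (le_of_lt hx))
          hn)))
  refine h.congr' ((eventually_gt_atTop 0).mono fun m hm => tsum_congr fun k => ?_)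
  have hm' : (m : ℝ) ≠ 0 := by exact_mod_cast hm.ne'
  field_simp

theorem limitFreeArea_zero : limitFreeArea 0 = limitArea := by
  simp only [limitFreeArea, zero_mul, neg_zero, exp_zero, mul_one]
  rw [integral_const_mul, integral_exp_neg_Ioi_zero, mul_one]

/-- The integrand has the explicit antiderivative exp(-t c e^{-x})/t, where c is `limitArea`. -/
theorem limitFreeArea_eq {t : ℝ} (ht : 0 < t) :
    limitFreeArea t = (1 - exp (-(limitArea * t))) / t := by
  have hd : ∀ x ∈ Set.Ici (0 : ℝ), HasDerivAt (fun x => exp (-(t * (limitArea * exp (-x)))) / t)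
      (limitArea * exp (-x) * exp (-(t * (limitArea * exp (-x))))) x := by
    intro x _
    have h1 : HasDerivAt (fun x => exp (-x)) (exp (-x) * (-1)) x := (hasDerivAt_neg x).exp
    have h2 := ((((h1.const_mul limitArea).const_mul t).fun_neg).exp).div_const t
    refine h2.congr_deriv ?_
    field_simp
  have hlim : Tendsto (fun x => exp (-(t * (limitArea * exp (-x)))) / t) atTop (𝓝 (1 / t)) := by
    have h1 : Tendsto (fun x : ℝ => exp (-x)) atTop (𝓝 0) := tendsto_exp_neg_atTop_nhds_zero
    have h2 := (((continuous_exp.tendsto _).comp ((h1.const_mul limitArea).const_mul t).neg)).div_const t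
    simpa [Function.comp_def] using h2
  have h := integral_Ioi_of_hasDerivAt_of_nonneg' hd (fun x _ => by
    have := limitArea_pos
    positivity) hlim
  rw [limitFreeArea, h]
  simp only [neg_zero, exp_zero, mul_one]
  rw [mul_comm t, sub_div]

end CellAreas

/-! ### The limiting entropy per column -/

section EntropyLimit

open Real

/-- Absorbing the logarithm into a square root leaves a bound which, for 1 - p = O(e^{-x}), decays
like e^{-x/2} and is still integrable. -/
theorem binEntropy_le_sqrt {p : ℝ} (hp : 0 ≤ p) (hp1 : p ≤ 1) : binEntropy p ≤ 3 * √(1 - p) := by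
  have hy0 : 0 ≤ 1 - p := by linarith
  have hs0 : 0 ≤ √(1 - p) := sqrt_nonneg _
  have hs1 : √(1 - p) ≤ 1 := sqrt_le_one.2 (by linarith)
  have hss : √(1 - p) * √(1 - p) = 1 - p := mul_self_sqrt hy0
  have h1 : negMulLog p ≤ 1 - p := by
    rcases hp.eq_or_lt with rfl | hp'
    · simp
    · have := one_sub_inv_le_log_of_pos hp'
      have h2 := mul_le_mul_of_nonneg_left this hp
      rw [mul_sub, mul_inv_cancel₀ hp'.ne'] at h2
      rw [negMulLog]
      linarith
  have h2 : negMulLog (1 - p) ≤ 2 * √(1 - p) := by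
    rcases hs0.eq_or_lt with h | h
    · rw [← hss, ← h]
      simp
    · have h3 := log_le_sub_one_of_pos (inv_pos.2 h)
      rw [log_inv] at h3
      have h4 : log (1 - p) = 2 * log √(1 - p) := by
        rw [log_sqrt hy0]
        ring
      have h7 : negMulLog (1 - p) = -(√(1 - p) * √(1 - p)) * (2 * log √(1 - p)) := by
        rw [negMulLog, h4, hss]
      rw [h7]
      have h5 := mul_le_mul_of_nonneg_left h3 (mul_nonneg hs0 hs0)
      have h6 : √(1 - p) * √(1 - p) * (√(1 - p))⁻¹ = √(1 - p) := by field_simp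
      rw [mul_sub, h6] at h5
      nlinarith
  rw [binEntropy_eq_negMulLog_add_negMulLog_one_sub]
  nlinarith

/-- The limiting entropy per column in nats, where `T` is `limitArea` times the number of
darts per column. -/
noncomputable def limitEntropy (T : ℝ) : ℝ :=
  ∫ x in Set.Ioi (0 : ℝ), binEntropy (exp (-(T * exp (-x))))

theorem one_sub_one_sub_pow_le {a : ℝ} (ha1 : a ≤ 1) (n : ℕ) :
    1 - (1 - a) ^ n ≤ n * a := by
  have := one_add_mul_le_pow (a := -a) (by linarith) n
  rw [← sub_eq_add_neg] at this
  linarith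

theorem binEntropy_one_sub_cellArea_pow_le (l m n : ℕ) (hm : 0 < m) (hn : n ≤ l * m) (x : ℝ) :
    |binEntropy ((1 - cellArea m ⌊(m : ℝ) * x⌋₊) ^ n)| ≤ 3 * √l * exp ((1 - x) / 2) := by
  have h0 := cellArea_nonneg m ⌊(m : ℝ) * x⌋₊
  have h1 := cellArea_le_one m ⌊(m : ℝ) * x⌋₊
  have hp0 : 0 ≤ (1 - cellArea m ⌊(m : ℝ) * x⌋₊) ^ n := pow_nonneg (by linarith) _
  have hp1 : (1 - cellArea m ⌊(m : ℝ) * x⌋₊) ^ n ≤ 1 := pow_le_one₀ (by linarith) (by linarith)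
  rw [abs_of_nonneg (binEntropy_nonneg hp0 hp1), mul_assoc]
  refine (binEntropy_le_sqrt hp0 hp1).trans (mul_le_mul_of_nonneg_left ?_ (by norm_num))
  have h2 : √(exp (1 - x)) = exp ((1 - x) / 2) := by
    rw [sqrt_eq_iff_mul_self_eq (exp_pos _).le (exp_pos _).le, ← exp_add]
    congr 1
    ring
  rw [← h2, ← sqrt_mul l.cast_nonneg]
  refine sqrt_le_sqrt ((one_sub_one_sub_pow_le h1 n).trans ?_)
  calc (n : ℝ) * cellArea m ⌊(m : ℝ) * x⌋₊ ≤ (l * m : ℝ) * cellArea m ⌊(m : ℝ) * x⌋₊ := by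
        gcongr
        exact_mod_cast hn
    _ = l * (m * cellArea m ⌊(m : ℝ) * x⌋₊) := by ring
    _ ≤ _ := mul_le_mul_of_nonneg_left (mul_cellArea_floor_le hm x) l.cast_nonneg

theorem integrableOn_exp_sub_div_two (b : ℝ) :
    IntegrableOn (fun x => b * exp ((1 - x) / 2)) (Set.Ioi 0) := by
  have := (integrableOn_exp_mul_Ioi (a := -(1 / 2)) (by norm_num) 0).const_mul (b * exp (1 / 2))
  refine this.congr (ae_of_all _ fun x => ?_)
  simp only
  rw [mul_assoc, ← exp_add]
  congr 2
  ring

theorem summable_binEntropy_cellArea {m : ℕ} (hm : 0 < m) (n : ℕ) :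
    Summable fun k => binEntropy ((1 - cellArea m k) ^ n) := by
  have h := (hasSum_div_of_le hm (f := fun k => binEntropy ((1 - cellArea m k) ^ n))
    (integrableOn_exp_sub_div_two (3 * √n)) fun x _ =>
      binEntropy_one_sub_cellArea_pow_le n m n hm (Nat.le_mul_of_pos_right n hm) x).summable
  have hm' : (m : ℝ) ≠ 0 := by exact_mod_cast hm.ne'
  refine (h.mul_right (m : ℝ)).congr fun k => ?_
  field_simp

theorem tendsto_binEntropy_cellArea (l : ℕ) {x : ℝ} (hx : 0 ≤ x) :
    Tendsto (fun m : ℕ => binEntropy ((1 - cellArea m ⌊(m : ℝ) * x⌋₊) ^ (l * m))) atTop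
      (𝓝 (binEntropy (exp (-(limitArea * l * exp (-x)))))) := by
  have hn : Tendsto (fun m : ℕ => ((l * m : ℕ) : ℝ) / m) atTop (𝓝 l) := by
    refine tendsto_const_nhds.congr' ((eventually_gt_atTop 0).mono fun m hm => ?_)
    have hm' : (m : ℝ) ≠ 0 := by exact_mod_cast hm.ne'
    push_cast
    field_simp
  have h := tendsto_one_sub_pow (fun m => cellArea_le_one m ⌊(m : ℝ) * x⌋₊)
    (tendsto_mul_cellArea hx) hn
  rw [show limitArea * l * exp (-x) = l * (limitArea * exp (-x)) by ring]
  exact (binEntropy_continuous.tendsto _).comp h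

theorem tendsto_tsum_binEntropy (l : ℕ) :
    Tendsto (fun m : ℕ => (∑' k, binEntropy ((1 - cellArea m k) ^ (l * m))) / m) atTop
      (𝓝 (limitEntropy (limitArea * l))) := by
  simp_rw [← tsum_div_const]
  exact tendsto_tsum_div (f := fun m k => binEntropy ((1 - cellArea m k) ^ (l * m)))
    (integrableOn_exp_sub_div_two (3 * √l))
    (fun m hm x _ => binEntropy_one_sub_cellArea_pow_le l m _ hm le_rfl x)
    ((ae_restrict_iff' measurableSet_Ioi).2 (ae_of_all _ fun x hx =>
      tendsto_binEntropy_cellArea l (le_of_lt hx)))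

theorem tendsto_sum_range_binEntropy (l J : ℕ) :
    Tendsto (fun m : ℕ => (∑ k ∈ Finset.range (J * m),
      binEntropy ((1 - cellArea m k) ^ (l * m))) / m) atTop
      (𝓝 (∫ x in (0 : ℝ)..J, binEntropy (exp (-(limitArea * l * exp (-x)))))) := by
  simp_rw [Finset.sum_div]
  refine tendsto_sum_range_div J (B := log 2)
    (f := fun m k => binEntropy ((1 - cellArea m k) ^ (l * m))) (fun m k _ _ => ?_) fun x hx _ =>
      tendsto_binEntropy_cellArea l hx.le
  have h0 := cellArea_nonneg m k
  have h1 := cellArea_le_one m k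
  rw [abs_of_nonneg (binEntropy_nonneg (pow_nonneg (by linarith) _)
    (pow_le_one₀ (by linarith) (by linarith)))]
  exact binEntropy_le_log_two

/-- The integral of the difference of two shifts of an integrable function. -/
theorem integral_shift_sub {f : ℝ → ℝ} (hf : ∀ a, IntegrableOn f (Set.Ioi a)) {b c : ℝ}
    (hbc : b ≤ c) :
    IntegrableOn (fun x => f (x - c) - f (x - b)) (Set.Ioi 0) ∧
    ∫ x in Set.Ioi (0 : ℝ), (f (x - c) - f (x - b)) = ∫ x in (-c)..(-b), f x := by
  have key : ∀ d : ℝ, IntegrableOn (fun x => f (x - d)) (Set.Ioi 0) ∧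
      ∫ x in Set.Ioi (0 : ℝ), f (x - d) = ∫ x in Set.Ioi (-d), f x := by
    intro d
    have e : (Set.Ioi (0 : ℝ)).indicator (fun x => f (x - d)) =
        fun x => (Set.Ioi (-d)).indicator f (x - d) := by
      funext x
      have : x - d ∈ Set.Ioi (-d) ↔ x ∈ Set.Ioi (0 : ℝ) := by
        simp [neg_lt_sub_iff_lt_add]
      by_cases hx : x ∈ Set.Ioi (0 : ℝ)
      · rw [Set.indicator_of_mem hx, Set.indicator_of_mem (this.2 hx)]
      · rw [Set.indicator_of_notMem hx, Set.indicator_of_notMem (mt this.1 hx)]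
    constructor
    · rw [← integrable_indicator_iff measurableSet_Ioi, e]
      exact ((integrable_indicator_iff measurableSet_Ioi).2 (hf _)).comp_sub_right d
    · rw [← integral_indicator measurableSet_Ioi, e, integral_sub_right_eq_self,
        integral_indicator measurableSet_Ioi]
  refine ⟨(key c).1.sub (key b).1, ?_⟩
  rw [integral_sub (key c).1 (key b).1, (key c).2, (key b).2]
  have h := intervalIntegral.integral_Ioi_sub_Ioi (hf (-c)) (neg_le_neg hbc)
  exact h

theorem integrableOn_one_sub_exp_exp {T : ℝ} (hT : 0 ≤ T) (a : ℝ) :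
    IntegrableOn (fun x => 1 - exp (-(T * exp (-x)))) (Set.Ioi a) := by
  refine Integrable.mono' ((integrableOn_exp_neg_Ioi a).const_mul T)
    (Continuous.aestronglyMeasurable (by fun_prop)) (ae_of_all _ fun x => ?_)
  have h1 : 0 ≤ T * exp (-x) := by positivity
  have h2 := add_one_le_exp (-(T * exp (-x)))
  have h3 : exp (-(T * exp (-x))) ≤ 1 := exp_le_one_iff.2 (by linarith)
  rw [norm_of_nonneg (by linarith)]
  linarith

/-- The contribution of one summand of the power series of the logarithm to the entropy. -/
noncomputable def entropyCoeff (T s : ℝ) : ℝ :=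
  ∫ x in (-log (s + 1))..(-log s), (1 - exp (-(T * exp (-x))))

/-- A Frullani integral: multiplying `T` by `s` translates x by log s, so the integral of the
difference collapses to an interval of length log(s + 1) - log s. -/
theorem integral_exp_sub_exp {T s : ℝ} (hT : 0 ≤ T) (hs : 0 < s) :
    IntegrableOn (fun x => exp (-(s * (T * exp (-x)))) - exp (-((s + 1) * (T * exp (-x)))))
      (Set.Ioi 0) ∧
    ∫ x in Set.Ioi (0 : ℝ), (exp (-(s * (T * exp (-x)))) - exp (-((s + 1) * (T * exp (-x))))) =
      entropyCoeff T s := by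
  have h := integral_shift_sub (fun a => integrableOn_one_sub_exp_exp hT a)
    (log_le_log hs (le_add_of_nonneg_right zero_le_one))
  have e : ∀ u : ℝ, 0 < u → ∀ x, T * exp (-(x - log u)) = u * (T * exp (-x)) := by
    intro u hu x
    rw [neg_sub, sub_eq_add_neg, exp_add, exp_log hu]
    ring
  have e2 : ∀ x : ℝ, (1 - exp (-(T * exp (-(x - log (s + 1)))))) -
      (1 - exp (-(T * exp (-(x - log s))))) =
      exp (-(s * (T * exp (-x)))) - exp (-((s + 1) * (T * exp (-x)))) := by
    intro x
    rw [e _ hs, e _ (by linarith)]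
    ring
  simp_rw [e2] at h
  exact h

theorem log_add_one_sub_log {s : ℝ} (hs : 0 < s) : log (s + 1) - log s = log (1 + 1 / s) := by
  rw [← log_div (by linarith) hs.ne']
  congr 1
  field_simp

/-- On the interval of integration e^{-x} ≥ s, so the integrand lies between 1 - e^{-Ts} and 1. -/
theorem entropyCoeff_bounds {T s : ℝ} (hT : 0 ≤ T) (hs : 0 < s) :
    log (1 + 1 / s) * (1 - exp (-(T * s))) ≤ entropyCoeff T s ∧
      entropyCoeff T s ≤ log (1 + 1 / s) := by
  have hle : -log (s + 1) ≤ -log s :=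
    neg_le_neg (log_le_log hs (le_add_of_nonneg_right zero_le_one))
  have hi : IntervalIntegrable (fun x => 1 - exp (-(T * exp (-x)))) volume (-log (s + 1))
      (-log s) := Continuous.intervalIntegrable (by fun_prop) _ _
  have hc : ∀ b : ℝ, ∫ _ in (-log (s + 1))..(-log s), b = log (1 + 1 / s) * b := by
    intro b
    rw [intervalIntegral.integral_const, smul_eq_mul, ← log_add_one_sub_log hs]
    ring
  constructor
  · rw [← hc]
    refine intervalIntegral.integral_mono_on hle intervalIntegrable_const hi fun x hx => ?_
    have h1 : s ≤ exp (-x) := by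
      rw [← log_le_iff_le_exp hs]
      linarith [hx.2]
    have h2 := mul_le_mul_of_nonneg_left h1 hT
    have h3 := exp_le_exp.2 (neg_le_neg h2)
    linarith
  · rw [← mul_one (log (1 + 1 / s)), ← hc]
    refine intervalIntegral.integral_mono_on hle hi intervalIntegrable_const fun x hx => ?_
    linarith [exp_pos (-(T * exp (-x)))]

theorem log_one_add_one_div_nonneg {s : ℝ} (hs : 0 < s) : 0 ≤ log (1 + 1 / s) :=
  log_nonneg (by linarith [one_div_pos.2 hs])

theorem entropyCoeff_nonneg {T s : ℝ} (hT : 0 ≤ T) (hs : 0 < s) : 0 ≤ entropyCoeff T s := by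
  refine le_trans (mul_nonneg (log_one_add_one_div_nonneg hs) ?_) (entropyCoeff_bounds hT hs).1
  have : exp (-(T * s)) ≤ 1 := exp_le_one_iff.2 (by
    rw [neg_nonpos]
    positivity)
  linarith

theorem tendsto_entropyCoeff {s : ℝ} (hs : 0 < s) :
    Tendsto (fun T => entropyCoeff T s) atTop (𝓝 (log (1 + 1 / s))) := by
  have h1 : Tendsto (fun T : ℝ => log (1 + 1 / s) * (1 - exp (-(T * s)))) atTop
      (𝓝 (log (1 + 1 / s))) := by
    have h2 : Tendsto (fun T : ℝ => exp (-(T * s))) atTop (𝓝 0) :=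
      tendsto_exp_neg_atTop_nhds_zero.comp (tendsto_id.atTop_mul_const hs)
    simpa using (h2.const_sub 1).const_mul (log (1 + 1 / s))
  exact tendsto_of_tendsto_of_tendsto_of_le_of_le' h1 tendsto_const_nhds
    ((eventually_ge_atTop 0).mono fun T hT => (entropyCoeff_bounds hT hs).1)
    ((eventually_ge_atTop 0).mono fun T hT => (entropyCoeff_bounds hT hs).2)

theorem inv_mul_log_le (k : ℕ) :
    ((k : ℝ) + 1)⁻¹ * log (1 + 1 / ((k : ℝ) + 1)) ≤ 1 / ((k : ℝ) + 1) ^ 2 := by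
  have hk : (0 : ℝ) < (k : ℝ) + 1 := by positivity
  have h := log_le_sub_one_of_pos (x := 1 + 1 / ((k : ℝ) + 1)) (by positivity)
  calc ((k : ℝ) + 1)⁻¹ * log (1 + 1 / ((k : ℝ) + 1)) ≤ ((k : ℝ) + 1)⁻¹ * (1 / ((k : ℝ) + 1)) := by
        gcongr
        linarith
    _ = _ := by field_simp

theorem summable_inv_mul_log :
    Summable fun k : ℕ => ((k : ℝ) + 1)⁻¹ * log (1 + 1 / ((k : ℝ) + 1)) := by
  refine Summable.of_nonneg_of_le (fun k => ?_) inv_mul_log_le ?_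
  · exact mul_nonneg (by positivity) (log_one_add_one_div_nonneg (by positivity))
  · have := (summable_nat_add_iff 1).2 (summable_one_div_nat_pow.2 (le_refl 2))
    simpa using this

/-- The left-over term is -(1 - y) log(1 - y) with y = e^{-v}; the logarithmic series multiplied by
1 - y gives differences of consecutive powers. -/
theorem hasSum_binEntropy_exp {v : ℝ} (hv : 0 < v) :
    HasSum (fun k : ℕ => ((k : ℝ) + 1)⁻¹ *
      (exp (-(((k : ℝ) + 1) * v)) - exp (-(((k : ℝ) + 1 + 1) * v))))
      (binEntropy (exp (-v)) - v * exp (-v)) := by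
  have hlt : exp (-v) < 1 := exp_lt_one_iff.2 (by linarith)
  have h := (hasSum_pow_div_log_of_abs_lt_one (x := exp (-v))
    (by rwa [abs_of_pos (exp_pos _)])).mul_left (1 - exp (-v))
  have e : binEntropy (exp (-v)) - v * exp (-v) = (1 - exp (-v)) * -log (1 - exp (-v)) := by
    rw [binEntropy_eq_negMulLog_add_negMulLog_one_sub, negMulLog, negMulLog, log_exp]
    ring
  rw [e]
  refine h.congr_fun fun k => ?_
  have h1 : exp (-(((k : ℝ) + 1) * v)) = exp (-v) ^ (k + 1) := by
    rw [← exp_nat_mul]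
    congr 1
    push_cast
    ring
  have h2 : exp (-(((k : ℝ) + 1 + 1) * v)) = exp (-v) ^ (k + 1) * exp (-v) := by
    rw [← h1, ← exp_add]
    congr 1
    ring
  rw [h1, h2]
  ring

theorem integrableOn_binEntropy_exp {T : ℝ} (hT : 0 ≤ T) :
    IntegrableOn (fun x => binEntropy (exp (-(T * exp (-x))))) (Set.Ioi 0) := by
  refine Integrable.mono' (integrableOn_exp_sub_div_two (3 * √T))
    (Continuous.aestronglyMeasurable (by fun_prop)) (ae_of_all _ fun x => ?_)
  have h1 : 0 ≤ T * exp (-x) := by positivity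
  have h2 : exp (-(T * exp (-x))) ≤ 1 := exp_le_one_iff.2 (by linarith)
  rw [norm_of_nonneg (binEntropy_nonneg (exp_pos _).le h2), mul_assoc]
  refine (binEntropy_le_sqrt (exp_pos _).le h2).trans
    (mul_le_mul_of_nonneg_left ?_ (by norm_num))
  have h3 := add_one_le_exp (-(T * exp (-x)))
  have h4 : √(exp (-x)) = exp (-x / 2) := by
    rw [sqrt_eq_iff_mul_self_eq (exp_pos _).le (exp_pos _).le, ← exp_add]
    congr 1
    ring
  calc √(1 - exp (-(T * exp (-x)))) ≤ √(T * exp (-x)) := sqrt_le_sqrt (by linarith)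
    _ = √T * exp (-x / 2) := by rw [sqrt_mul hT, h4]
    _ ≤ _ := by
      gcongr
      linarith

/-- Put v = T e^{-x} in the series for the binary entropy and integrate termwise. The term v e^{-v}
is the derivative of exp(-T e^{-x}), which rises from e^{-T} at 0 to 1 at infinity. -/
theorem limitEntropy_eq {T : ℝ} (hT : 0 < T) :
    limitEntropy T = 1 - exp (-T) + ∑' k : ℕ, ((k : ℝ) + 1)⁻¹ * entropyCoeff T ((k : ℝ) + 1) := by
  set F : ℕ → ℝ → ℝ := fun k x => ((k : ℝ) + 1)⁻¹ *
      (exp (-(((k : ℝ) + 1) * (T * exp (-x)))) - exp (-(((k : ℝ) + 1 + 1) * (T * exp (-x)))))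
  have hpt : ∀ x : ℝ, binEntropy (exp (-(T * exp (-x)))) =
      T * exp (-x) * exp (-(T * exp (-x))) + ∑' k, F k x := by
    intro x
    rw [(hasSum_binEntropy_exp (by positivity : 0 < T * exp (-x))).tsum_eq]
    ring
  have hFi : ∀ k, IntegrableOn (F k) (Set.Ioi 0) := fun k =>
    (integral_exp_sub_exp hT.le (by positivity : (0 : ℝ) < (k : ℝ) + 1)).1.const_mul _
  have hF0 : ∀ k x, 0 ≤ F k x := by
    intro k x
    refine mul_nonneg (by positivity) (sub_nonneg.2 (exp_le_exp.2 (neg_le_neg ?_)))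
    gcongr
    linarith
  have hFint : ∀ k, ∫ x in Set.Ioi (0 : ℝ), F k x =
      ((k : ℝ) + 1)⁻¹ * entropyCoeff T ((k : ℝ) + 1) := fun k => by
    rw [integral_const_mul, (integral_exp_sub_exp hT.le (by positivity)).2]
  have hsum : Summable fun k => ∫ x in Set.Ioi (0 : ℝ), ‖F k x‖ := by
    simp_rw [norm_of_nonneg (hF0 _ _), hFint]
    refine Summable.of_nonneg_of_le (fun k => mul_nonneg (by positivity)
      (entropyCoeff_nonneg hT.le (by positivity))) (fun k => ?_) summable_inv_mul_log
    exact mul_le_mul_of_nonneg_left (entropyCoeff_bounds hT.le (by positivity)).2 (by positivity)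
  have h1 := hasSum_integral_of_summable_integral_norm hFi hsum
  have hd : ∀ x ∈ Set.Ici (0 : ℝ), HasDerivAt (fun x => exp (-(T * exp (-x))))
      (T * exp (-x) * exp (-(T * exp (-x)))) x := by
    intro x _
    have h2 : HasDerivAt (fun x => exp (-x)) (exp (-x) * (-1)) x := (hasDerivAt_neg x).exp
    refine ((h2.const_mul T).fun_neg.exp).congr_deriv ?_
    ring
  have hlim : Tendsto (fun x => exp (-(T * exp (-x)))) atTop (𝓝 1) := by
    have h2 : Tendsto (fun x : ℝ => exp (-x)) atTop (𝓝 0) := tendsto_exp_neg_atTop_nhds_zero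
    simpa [Function.comp_def] using (continuous_exp.tendsto _).comp (h2.const_mul T).neg
  have hpos : ∀ x ∈ Set.Ioi (0 : ℝ), 0 ≤ T * exp (-x) * exp (-(T * exp (-x))) :=
    fun x _ => by positivity
  have h3 := integral_Ioi_of_hasDerivAt_of_nonneg' hd hpos hlim
  have h3i := integrableOn_Ioi_deriv_of_nonneg' hd hpos hlim
  have hFti : IntegrableOn (fun x => ∑' k, F k x) (Set.Ioi 0) := by
    refine ((integrableOn_binEntropy_exp hT.le).sub h3i).congr (ae_of_all _ fun x => ?_)
    simp only [Pi.sub_apply, hpt]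
    ring
  rw [limitEntropy]
  simp_rw [hpt]
  rw [integral_add h3i hFti, h3, ← h1.tsum_eq]
  simp_rw [hFint]
  simp

theorem tendsto_limitEntropy :
    Tendsto limitEntropy atTop
      (𝓝 (1 + ∑' k : ℕ, ((k : ℝ) + 1)⁻¹ * log (1 + 1 / ((k : ℝ) + 1)))) := by
  have h1 : Tendsto (fun T => ∑' k : ℕ, ((k : ℝ) + 1)⁻¹ * entropyCoeff T ((k : ℝ) + 1)) atTop
      (𝓝 (∑' k : ℕ, ((k : ℝ) + 1)⁻¹ * log (1 + 1 / ((k : ℝ) + 1)))) := by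
    refine tendsto_tsum_of_dominated_convergence summable_inv_mul_log
      (fun k => (tendsto_entropyCoeff (by positivity)).const_mul _)
      ((eventually_ge_atTop 0).mono fun T hT k => ?_)
    rw [norm_of_nonneg (mul_nonneg (by positivity) (entropyCoeff_nonneg hT (by positivity)))]
    exact mul_le_mul_of_nonneg_left (entropyCoeff_bounds hT (by positivity)).2 (by positivity)
  have h2 : Tendsto (fun T : ℝ => 1 - exp (-T)) atTop (𝓝 1) := by
    simpa using tendsto_exp_neg_atTop_nhds_zero.const_sub 1
  refine (h2.add h1).congr' ((eventually_gt_atTop 0).mono fun T hT => ?_)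
  exact (limitEntropy_eq hT).symm

theorem H0_eq : H0 = (1 + ∑' k : ℕ, ((k : ℝ) + 1)⁻¹ * log (1 + 1 / ((k : ℝ) + 1))) / log 2 := by
  rw [H0, add_div, ← tsum_div_const, one_div]
  congr 1
  refine tsum_congr fun k => ?_
  rw [logb, mul_div_assoc]

end EntropyLimit

/-! ### Numerical value of H₀/2 -/

section NumericalValue

open Real

/-- One term and the remainder of the series of log((1 + x)/(1 - x)) at x = 1/(2s + 1). -/
theorem log_one_add_inv_bounds {s : ℝ} (hs : 0 < s) :
    2 / (2 * s + 1) ≤ log (1 + 1 / s) ∧ log (1 + 1 / s) ≤ (2 * s + 1) / (2 * s * (s + 1)) := by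
  have hx0 : 0 ≤ 1 / (2 * s + 1) := by positivity
  have hx1 : 1 / (2 * s + 1) < 1 := (div_lt_one (by positivity)).2 (by linarith)
  have e : (1 + 1 / (2 * s + 1)) / (1 - 1 / (2 * s + 1)) = 1 + 1 / s := by
    have : (2 * s + 1 - 1 : ℝ) ≠ 0 := by
      rw [add_sub_cancel_right]
      positivity
    field_simp
    ring
  have h1 := sum_range_le_log_div hx0 hx1 1
  have h2 := log_div_le_sum_range_add hx0 hx1 1
  rw [e] at h1 h2
  simp at h1 h2
  have e2 : (2 * s + 1)⁻¹ + ((2 * s + 1) ^ 3)⁻¹ / (1 - ((2 * s + 1) ^ 2)⁻¹) =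
      2⁻¹ * ((2 * s + 1) / (2 * s * (s + 1))) := by
    have h3 : 1 - ((2 * s + 1) ^ 2)⁻¹ = 4 * s * (s + 1) / (2 * s + 1) ^ 2 := by
      field_simp
      ring
    rw [h3]
    field_simp
    ring
  rw [e2] at h2
  rw [one_div]
  constructor
  · rw [div_eq_mul_inv]
    linarith
  · linarith

/-- The terms behave like 1/(s(s + 1/2)) with s = k + 5, and 1/((k + b)(k + 1 + b)) matches this to
leading orders at b = 4.75. Moving b slightly up or down gives telescoping bounds on either side. -/
theorem tail_bounds :
    1 / 4.77 ≤ ∑' k : ℕ, (((k + 4 : ℕ) : ℝ) + 1)⁻¹ * log (1 + 1 / (((k + 4 : ℕ) : ℝ) + 1)) ∧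
    ∑' k : ℕ, (((k + 4 : ℕ) : ℝ) + 1)⁻¹ * log (1 + 1 / (((k + 4 : ℕ) : ℝ) + 1)) ≤ 1 / 4.74 := by
  set f : ℕ → ℝ := fun k => (((k + 4 : ℕ) : ℝ) + 1)⁻¹ * log (1 + 1 / (((k + 4 : ℕ) : ℝ) + 1))
  have hs : Summable f := (summable_nat_add_iff 4).2 summable_inv_mul_log
  have hf0 : ∀ k, 0 ≤ f k := fun k =>
    mul_nonneg (by positivity) (log_one_add_one_div_nonneg (by positivity))
  have hlow : ∀ k : ℕ, 1 / ((k : ℝ) + 4.77) - 1 / ((k : ℝ) + 1 + 4.77) ≤ f k := by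
    intro k
    have hk : (0 : ℝ) ≤ k := k.cast_nonneg
    have h := (log_one_add_inv_bounds (s := ((k + 4 : ℕ) : ℝ) + 1) (by positivity)).1
    refine le_trans ?_ (mul_le_mul_of_nonneg_left h (by positivity))
    push_cast
    rw [div_sub_div _ _ (by positivity) (by positivity), inv_mul_eq_div, div_div,
      div_le_div_iff₀ (by positivity) (by positivity)]
    nlinarith
  have hup : ∀ k : ℕ, f k ≤ 1 / ((k : ℝ) + 4.74) - 1 / ((k : ℝ) + 1 + 4.74) := by
    intro k
    have hk : (0 : ℝ) ≤ k := k.cast_nonneg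
    have h := (log_one_add_inv_bounds (s := ((k + 4 : ℕ) : ℝ) + 1) (by positivity)).2
    refine le_trans (mul_le_mul_of_nonneg_left h (by positivity)) ?_
    push_cast
    rw [div_sub_div _ _ (by positivity) (by positivity), inv_mul_eq_div, div_div,
      div_le_div_iff₀ (by positivity) (by positivity)]
    nlinarith [pow_nonneg hk 2, pow_nonneg hk 3, pow_nonneg hk 4]
  have htel : ∀ (b : ℝ) (n : ℕ), ∑ k ∈ Finset.range n,
      (1 / ((k : ℝ) + b) - 1 / ((k : ℝ) + 1 + b)) = 1 / b - 1 / ((n : ℝ) + b) := by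
    intro b n
    have := Finset.sum_range_sub' (fun k : ℕ => 1 / ((k : ℝ) + b)) n
    simpa using this
  constructor
  · have hlim : Tendsto (fun n : ℕ => 1 / (4.77 : ℝ) - 1 / ((n : ℝ) + 4.77)) atTop
        (𝓝 (1 / 4.77 - 0)) := by
      refine tendsto_const_nhds.sub ?_
      simp only [one_div]
      exact tendsto_inv_atTop_zero.comp
        (tendsto_atTop_add_const_right _ _ tendsto_natCast_atTop_atTop)
    rw [sub_zero] at hlim
    refine le_of_tendsto hlim (Eventually.of_forall fun n => ?_)
    rw [← htel]
    exact (Finset.sum_le_sum fun k _ => hlow k).trans (hs.sum_le_tsum _ fun k _ => hf0 k)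
  · refine Real.tsum_le_of_sum_range_le hf0 fun n => ?_
    refine (Finset.sum_le_sum fun k _ => hup k).trans ?_
    rw [htel]
    have : (0 : ℝ) ≤ 1 / ((n : ℝ) + 4.74) := by positivity
    linarith

theorem abs_H0_div_two_sub_lt : |H0 / 2 - 1.63| < 0.005 := by
  obtain ⟨t1, t2⟩ := tail_bounds
  have hsum := summable_inv_mul_log.sum_add_tsum_nat_add 4
  have b2 := log_one_add_inv_bounds (s := 2) (by norm_num)
  have b3 := log_one_add_inv_bounds (s := 3) (by norm_num)
  have b4 := log_one_add_inv_bounds (s := 4) (by norm_num)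
  have l1 := log_two_gt_d9
  have l2 := log_two_lt_d9
  simp only [Finset.sum_range_succ, Finset.sum_range_zero] at hsum
  norm_num at hsum b2 b3 b4 t1 t2
  rw [H0_eq, abs_lt]
  simp only [one_div]
  have hl : 0 < log 2 := by linarith
  rw [← hsum, div_div, lt_sub_iff_add_lt, sub_lt_iff_lt_add, lt_div_iff₀ (by positivity),
    div_lt_iff₀ (by positivity)]
  constructor <;> linarith

end NumericalValue

/-! ### From the dartboard to iid outcomes -/

section Geometry

open Real

/-- The rank of a cell in the order of decreasing area. -/
def cellRank (m : ℕ) [NeZero m] : Fin m × ℕ ≃ ℕ :=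
  (Equiv.prodComm _ _).trans (Nat.divModEquiv m).symm

theorem cellRank_apply {m : ℕ} [NeZero m] (c : Fin m × ℕ) : cellRank m c = c.2 * m + c.1 := rfl

/-- The effect of smoothing: the exponents of all columns together run through the multiples of 1/m,
each exactly once. -/
theorem offset_add {m : ℕ} [NeZero m] (c : Fin m × ℕ) :
    offset c.1 + (c.2 : ℝ) = (cellRank m c : ℝ) / m := by
  have hm : (m : ℝ) ≠ 0 := by exact_mod_cast NeZero.ne m
  rw [cellRank_apply, offset]
  push_cast
  field_simp
  ring

theorem measurableSet_cellRegion (q : ℝ) {m : ℕ} (c : Fin m × ℕ) :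
    MeasurableSet (cellRegion q c) := measurableSet_Ico.prod measurableSet_Ico

theorem dartLaw_real_cellRegion {m : ℕ} [NeZero m] (c : Fin m × ℕ) :
    dartLaw.real (cellRegion (exp 1) c) = cellArea m (cellRank m c) := by
  have hm0 : 0 < m := Nat.pos_of_ne_zero (NeZero.ne m)
  have hm : (0 : ℝ) < m := by exact_mod_cast hm0
  have hsub : cellRegion (exp 1) c ⊆ Set.Icc (0 : ℝ) 1 ×ˢ Set.Icc (0 : ℝ) 1 := by
    rintro ⟨x, y⟩ ⟨hx, hy⟩
    simp only [exp_one_rpow] at hx hy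
    have h1 : ((c.1 : ℝ) + 1) / m ≤ 1 := by
      rw [div_le_one hm]
      exact_mod_cast c.1.2
    have h2 : exp (-(offset c.1 + (c.2 : ℝ))) ≤ 1 := by
      rw [exp_le_one_iff, neg_nonpos, offset_add]
      positivity
    exact ⟨⟨le_trans (by positivity) hx.1, hx.2.le.trans h1⟩,
      ⟨(exp_pos _).le.trans hy.1, hy.2.le.trans h2⟩⟩
  rw [measureReal_def, dartLaw, Measure.restrict_apply (measurableSet_cellRegion _ _),
    Set.inter_eq_left.2 hsub, cellRegion, Measure.volume_eq_prod, Measure.prod_prod,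
    Real.volume_Ico, Real.volume_Ico, ENNReal.toReal_mul]
  simp only [exp_one_rpow]
  rw [ENNReal.toReal_ofReal (by rw [← sub_div]; simp), ENNReal.toReal_ofReal (by
    rw [sub_nonneg, exp_le_exp]
    linarith)]
  rw [← add_assoc, offset_add, cellArea, limitArea, neg_add, exp_add, ← sub_div]
  ring

theorem cellRegion_unique {m : ℕ} {c d : Fin m × ℕ} {y : ℝ × ℝ} (hc : y ∈ cellRegion (exp 1) c)
    (hd : y ∈ cellRegion (exp 1) d) : c = d := by
  have hm : 0 < m := c.1.pos
  obtain ⟨hc1, hc2⟩ := hc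
  obtain ⟨hd1, hd2⟩ := hd
  have h1 : c.1 = d.1 := by
    ext
    rw [← floor_mul_eq hm hc1, ← floor_mul_eq hm hd1]
  simp only [exp_one_rpow, h1, Set.mem_Ico] at hc2 hd2
  have a1 := exp_lt_exp.1 (hc2.1.trans_lt hd2.2)
  have a2 := exp_lt_exp.1 (hd2.1.trans_lt hc2.2)
  have b1 : d.2 < c.2 + 1 := by
    have : (d.2 : ℝ) < (c.2 : ℝ) + 1 := by linarith
    exact_mod_cast this
  have b2 : c.2 < d.2 + 1 := by
    have : (c.2 : ℝ) < (d.2 : ℝ) + 1 := by linarith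
    exact_mod_cast this
  exact Prod.ext h1 (by omega)

theorem cellOf_eq_some_iff {m : ℕ} {c : Fin m × ℕ} {y : ℝ × ℝ} :
    cellOf (exp 1) m y = some c ↔ y ∈ cellRegion (exp 1) c := by
  unfold cellOf
  split_ifs with h
  · rw [Option.some_inj]
    constructor
    · rintro rfl
      exact h.choose_spec
    · exact fun hc => cellRegion_unique h.choose_spec hc
  · simp only [false_iff]
    exact fun hc => h ⟨c, hc⟩

theorem measurable_cellOf (m : ℕ) : Measurable (cellOf (exp 1) m) := by
  refine measurable_to_countable' fun o => ?_
  have hsome : ∀ c, cellOf (exp 1) m ⁻¹' {some c} = cellRegion (exp 1) c := fun c => by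
    ext y
    exact cellOf_eq_some_iff
  cases o with
  | some c =>
    rw [hsome]
    exact measurableSet_cellRegion _ _
  | none =>
    have : cellOf (exp 1) m ⁻¹' {none} = (⋃ c : Fin m × ℕ, cellRegion (exp 1) c)ᶜ := by
      ext y
      simp only [Set.mem_preimage, Set.mem_singleton_iff, Set.mem_compl_iff, Set.mem_iUnion,
        not_exists, Option.eq_none_iff_forall_ne_some, ne_eq, cellOf_eq_some_iff]
    rw [this]
    exact (MeasurableSet.iUnion fun c => measurableSet_cellRegion _ _).compl

/-- The law of the cell that is hit by a dart. -/
noncomputable def cellLaw (m : ℕ) : Measure (Option (Fin m × ℕ)) := dartLaw.map (cellOf (exp 1) m)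

theorem cellLaw_real_some {m : ℕ} [NeZero m] (c : Fin m × ℕ) :
    (cellLaw m).real {some c} = cellArea m (cellRank m c) := by
  rw [cellLaw, map_measureReal_apply (measurable_cellOf m) MeasurableSet.of_discrete,
    ← dartLaw_real_cellRegion]
  congr 1
  ext y
  exact cellOf_eq_some_iff

theorem sketch_eq_occupied (q : ℝ) (m : ℕ) (x : ℕ → ℝ × ℝ) (n : ℕ) :
    sketch q m x n = occupied (fun k => cellOf q m (x k)) n := by
  induction n with
  | zero => rfl
  | succ n ih => rw [sketch, occupied, update, ih]

theorem changeProb_eq_freeArea (m : ℕ) (x : ℕ → ℝ × ℝ) (k : ℕ) :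
    changeProb (exp 1) m x k =
      freeArea (cellLaw m) (occupied (fun i => cellOf (exp 1) m (x i)) (k - 1)) := by
  rw [changeProb, freeArea, cellLaw, map_measureReal_apply (measurable_cellOf m)
    MeasurableSet.of_discrete, sketch_eq_occupied]
  congr 1
  ext y
  exact union_toFinset_ne_iff

theorem martingaleEstimator_eq_estimate (m : ℕ) (x : ℕ → ℝ × ℝ) (n : ℕ) :
    martingaleEstimator (exp 1) m x n =
      estimate (cellLaw m) (fun i => cellOf (exp 1) m (x i)) n := by
  induction n with
  | zero => simp [martingaleEstimator, estimate]
  | succ n ih =>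
    rw [martingaleEstimator, Finset.sum_Icc_succ_top (by omega), ← martingaleEstimator, ih,
      estimate, estimate, Finset.sum_range_succ, changeProb_eq_freeArea]
    simp only [sketch_eq_occupied, Nat.add_sub_cancel]

theorem tsum_cellRank {m : ℕ} [NeZero m] (g : ℝ → ℝ) :
    ∑' c : Fin m × ℕ, g ((cellLaw m).real {some c}) = ∑' k, g (cellArea m k) := by
  simp_rw [cellLaw_real_some]
  exact (cellRank m).tsum_eq fun k => g (cellArea m k)

/-- The `N` largest cells. -/
def largestCells (m N : ℕ) [NeZero m] : Finset (Fin m × ℕ) :=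
  (Finset.range N).map (cellRank m).symm.toEmbedding

theorem sum_largestCells {m : ℕ} [NeZero m] (N : ℕ) (g : ℝ → ℝ) :
    ∑ c ∈ largestCells m N, g ((cellLaw m).real {some c}) =
      ∑ k ∈ Finset.range N, g (cellArea m k) := by
  rw [largestCells, Finset.sum_map]
  refine Finset.sum_congr rfl fun k _ => ?_
  rw [cellLaw_real_some]
  simp

theorem cellArea_anti (m : ℕ) : Antitone (cellArea m) := by
  intro k l hkl
  have := limitArea_pos
  unfold cellArea
  gcongr

/-- After `k` outcomes at least `r` of the `N` largest cells are free, and each of these has area at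
least `cellArea m N`. -/
theorem mul_cellArea_le_freeArea {m : ℕ} [NeZero m] [IsProbabilityMeasure (cellLaw m)] {k r N : ℕ}
    (h : k + r ≤ N) (y : ℕ → Option (Fin m × ℕ)) :
    r * cellArea m N ≤ freeArea (cellLaw m) (occupied y k) := by
  refine freeArea_ge (T := largestCells m N) (fun c hc => ?_) (cellArea_nonneg m N) ?_
  · obtain ⟨j, hj, rfl⟩ := Finset.mem_map.1 hc
    rw [cellLaw_real_some]
    simpa using cellArea_anti m (Finset.mem_range.1 hj).le
  · have := card_occupied_le y k
    simp only [largestCells, Finset.card_map, Finset.card_range]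
    omega

section Darts

variable {Ω : Type*} [MeasurableSpace Ω] {μ : Measure Ω} [IsProbabilityMeasure μ]
  {dart : ℕ → ℕ → Ω → ℝ × ℝ}

theorem isIIDSequence_cellOf (hm : ∀ m k, Measurable (dart m k))
    (hl : ∀ m k, μ.map (dart m k) = dartLaw) (hi : ∀ m, iIndepFun (dart m) μ) (m : ℕ) :
    IsIIDSequence μ (cellLaw m) (fun k ω => cellOf (exp 1) m (dart m k ω)) where
  measurable k := (measurable_cellOf m).comp (hm m k)
  law k := by
    rw [cellLaw, ← hl m k, Measure.map_map (measurable_cellOf m) (hm m k)]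
    rfl
  indep := (hi m).comp (fun _ => cellOf (exp 1) m) fun _ => measurable_cellOf m

end Darts

end Geometry

/-! ### Limits of free area, variance and entropy for many columns -/

section Limits

open Real

variable {Ω : Type*} [MeasurableSpace Ω] {μ : Measure Ω} [IsProbabilityMeasure μ]
  {Y : (m : ℕ) → ℕ → Ω → Option (Fin m × ℕ)}

theorem integral_freeArea_deviation_le (hY : ∀ m, IsIIDSequence μ (cellLaw m) (Y m)) {m n B : ℕ}
    (hm : 0 < m) (hn : n ≤ B * m) :
    ∫ ω, (freeArea (cellLaw m) (occupied (fun i => Y m i ω) n) -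
      expectedFreeArea (cellLaw m) n (∅ : Finset (Fin m × ℕ))) ^ 4 ∂μ ≤
      48 * exp (B / 8) * (1 / (m : ℝ) ^ 2) := by
  have : NeZero m := ⟨hm.ne'⟩
  have hm' : (0 : ℝ) < m := by exact_mod_cast hm
  -- With cells of area at most 1/m and θ = √m, the exponent n θ² A²/8 stays bounded by B/8, while
  -- θ⁴ = m² gives the decay.
  have h := (hY m).integral_pow_four_le (A := 1 / m) (fun c => by
    rw [cellLaw_real_some]
    exact cellArea_le m _) (by positivity) (√m) n
  have e1 : √(m : ℝ) ^ 2 = m := sq_sqrt hm'.le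
  have e2 : √(m : ℝ) ^ 4 = (m : ℝ) ^ 2 := by
    rw [show 4 = 2 * 2 by rfl, pow_mul, e1]
  rw [e1, e2] at h
  have h2 : (n : ℝ) * (m * (1 / m) ^ 2 / 8) ≤ B / 8 := by
    have e3 : (n : ℝ) * (m * (1 / m) ^ 2 / 8) = n / m / 8 := by field_simp
    have e4 : (n : ℝ) / m ≤ B := by
      rw [div_le_iff₀ hm']
      exact_mod_cast hn
    rw [e3]
    linarith
  have h3 := exp_le_exp.2 h2
  rw [mul_one_div, le_div_iff₀ (by positivity), mul_comm]
  linarith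

/-- The free area after about `t m` darts converges almost surely. -/
theorem ae_tendsto_freeArea (hY : ∀ m, IsIIDSequence μ (cellLaw m) (Y m)) {n : ℕ → ℕ} {B : ℕ}
    {t : ℝ} (hnB : ∀ m, n m ≤ B * m) (hn : Tendsto (fun m => (n m : ℝ) / m) atTop (𝓝 t)) :
    ∀ᵐ ω ∂μ, Tendsto (fun m => freeArea (cellLaw m) (occupied (fun i => Y m i ω) (n m))) atTop
      (𝓝 (limitFreeArea t)) := by
  have hprob : ∀ m, IsProbabilityMeasure (cellLaw m) := fun m => (hY m).isProbabilityMeasure_law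
  set X : ℕ → Ω → ℝ := fun m ω => freeArea (cellLaw m) (occupied (fun i => Y m i ω) (n m)) -
      expectedFreeArea (cellLaw m) (n m) (∅ : Finset (Fin m × ℕ)) with hX
  have hi : ∀ m, Integrable (fun ω => X m ω ^ 4) μ := fun m =>
    (hY m).integrable_of_dependsOnFirst (k := n m)
      (f := fun y => (freeArea (cellLaw m) (occupied y (n m)) -
        expectedFreeArea (cellLaw m) (n m) (∅ : Finset (Fin m × ℕ))) ^ 4) (B := 1)
      (fun y y' hy => by simp only [occupied_congr (n m) y y' hy]) fun y => by
        have h1 := freeArea_nonneg (ν := cellLaw m) (occupied y (n m))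
        have h2 := freeArea_le_one (ν := cellLaw m) (occupied y (n m))
        have h3 := expectedFreeArea_nonneg (ν := cellLaw m) (n m) ∅
        have h4 := expectedFreeArea_le_one (ν := cellLaw m) (n m) ∅
        rw [abs_pow]
        refine pow_le_one₀ (abs_nonneg _) ?_
        rw [abs_le]
        constructor <;> linarith
  have hs : Summable fun m => ∫ ω, X m ω ^ 4 ∂μ := by
    refine Summable.of_norm_bounded_eventually_nat
      ((summable_one_div_nat_pow.2 (le_refl 2)).mul_left (48 * exp (B / 8)))
      ((eventually_gt_atTop 0).mono fun m hm => ?_)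
    rw [norm_of_nonneg (integral_nonneg fun ω => by positivity)]
    exact integral_freeArea_deviation_le hY hm (hnB m)
  have hmean : Tendsto (fun m => expectedFreeArea (cellLaw m) (n m) (∅ : Finset (Fin m × ℕ))) atTop
      (𝓝 (limitFreeArea t)) := by
    refine (tendsto_tsum_cellArea_mul_pow hn).congr' ((eventually_gt_atTop 0).mono fun m hm => ?_)
    have : NeZero m := ⟨hm.ne'⟩
    rw [← tsum_cellRank fun a => a * (1 - a) ^ n m]
    simp [expectedFreeArea]
  filter_upwards [ae_tendsto_zero_of_summable_pow_four hi hs] with ω hω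
  simpa [X] using hω.add hmean

theorem tendsto_mul_div (l : ℕ) :
    Tendsto (fun m : ℕ => ((l * m : ℕ) : ℝ) / m) atTop (𝓝 l) := by
  refine tendsto_const_nhds.congr' ((eventually_gt_atTop 0).mono fun m hm => ?_)
  have hm' : (m : ℝ) ≠ 0 := by exact_mod_cast hm.ne'
  push_cast
  field_simp

theorem tendsto_mul_sub_one_div {l : ℕ} (hl : 1 ≤ l) :
    Tendsto (fun m : ℕ => ((l * m - 1 : ℕ) : ℝ) / m) atTop (𝓝 l) := by
  have h : Tendsto (fun m : ℕ => ((l * m : ℕ) : ℝ) / m - 1 / m) atTop (𝓝 (l - 0)) :=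
    (tendsto_mul_div l).sub tendsto_one_div_atTop_nhds_zero_nat
  rw [sub_zero] at h
  refine h.congr' ((eventually_gt_atTop 0).mono fun m hm => ?_)
  have h1 : 1 ≤ l * m := Nat.mul_pos hl hm
  simp only [Nat.cast_sub h1, Nat.cast_one, sub_div]

theorem tendsto_exp_neg_mul_natCast :
    Tendsto (fun l : ℕ => exp (-(limitArea * l))) atTop (𝓝 0) :=
  tendsto_exp_neg_atTop_nhds_zero.comp
    (tendsto_natCast_atTop_atTop.const_mul_atTop limitArea_pos)

/-- The limiting normalized variance of the estimator after `l m` darts. -/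
noncomputable def limitVariance (l : ℕ) : ℝ :=
  (∫ x in (0 : ℝ)..l, (1 / limitFreeArea x - 1)) / (l : ℝ) ^ 2

/-- Both bounds follow from the closed form; the upper one is (1 + u) e^{-u} ≤ 1 with u = `limitArea
* x`. -/
theorem inv_limitFreeArea_bounds {x : ℝ} (hx : 0 < x) :
    x ≤ 1 / limitFreeArea x ∧ 1 / limitFreeArea x ≤ x + 1 / limitArea := by
  have hc := limitArea_pos
  have hu : 0 < limitArea * x := by positivity
  have h1 : exp (-(limitArea * x)) < 1 := exp_lt_one_iff.2 (by linarith)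
  have h2 : (limitArea * x + 1) * exp (-(limitArea * x)) ≤ 1 := by
    rw [exp_neg, ← div_eq_mul_inv, div_le_one (exp_pos _)]
    exact add_one_le_exp _
  have hd : 0 < 1 - exp (-(limitArea * x)) := by linarith
  rw [limitFreeArea_eq hx, one_div_div]
  constructor
  · rw [le_div_iff₀ hd]
    nlinarith [exp_pos (-(limitArea * x))]
  · rw [div_le_iff₀ hd]
    have e : (x + 1 / limitArea) * (1 - exp (-(limitArea * x))) =
        x + (1 - (limitArea * x + 1) * exp (-(limitArea * x))) / limitArea := by
      field_simp
      ring
    rw [e]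
    have := div_nonneg (sub_nonneg.2 h2) hc.le
    linarith

theorem intervalIntegrable_inv_limitFreeArea (l : ℕ) :
    IntervalIntegrable (fun x => 1 / limitFreeArea x - 1) volume 0 l := by
  rw [intervalIntegrable_iff_integrableOn_Ioc_of_le l.cast_nonneg]
  refine Integrable.sub ?_ (integrableOn_const (by simp))
  have hm : AEStronglyMeasurable (fun x : ℝ => 1 / limitFreeArea x)
      (volume.restrict (Set.Ioc 0 (l : ℝ))) := by
    have h1 : Measurable fun x : ℝ => 1 / ((1 - exp (-(limitArea * x))) / x) := by fun_prop
    refine h1.aestronglyMeasurable.congr ((ae_restrict_iff' measurableSet_Ioc).2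
      (ae_of_all _ fun x hx => ?_))
    simp only [limitFreeArea_eq hx.1]
  refine Integrable.mono' (g := fun x => x + 1 / limitArea)
    (Continuous.integrableOn_Ioc (by fun_prop)) hm ((ae_restrict_iff' measurableSet_Ioc).2
      (ae_of_all _ fun x hx => ?_))
  have := inv_limitFreeArea_bounds hx.1
  rw [norm_of_nonneg (hx.1.le.trans this.1)]
  exact this.2

theorem limitVariance_bounds {l : ℕ} (hl : 0 < l) :
    1 / 2 - 1 / (l : ℝ) ≤ limitVariance l ∧
      limitVariance l ≤ 1 / 2 + (1 / limitArea - 1) * (1 / (l : ℝ)) := by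
  have hl' : (0 : ℝ) < l := by exact_mod_cast hl
  have hint : ∀ b : ℝ, ∫ x in (0 : ℝ)..l, (x + b) = (l : ℝ) ^ 2 / 2 + b * l := by
    intro b
    rw [intervalIntegral.integral_add (by simp) (by simp), integral_id]
    simp
    ring
  have hcont : ∀ b : ℝ, IntervalIntegrable (fun x : ℝ => x + b) volume 0 l := fun b =>
    Continuous.intervalIntegrable (by fun_prop) _ _
  have h1 := intervalIntegral.integral_mono_on_of_le_Ioo l.cast_nonneg (hcont (-1))
    (intervalIntegrable_inv_limitFreeArea l) fun x hx => by
      linarith [(inv_limitFreeArea_bounds hx.1).1]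
  have h2 := intervalIntegral.integral_mono_on_of_le_Ioo l.cast_nonneg
    (intervalIntegrable_inv_limitFreeArea l) (hcont (1 / limitArea - 1)) fun x hx => by
      linarith [(inv_limitFreeArea_bounds hx.1).2]
  rw [hint] at h1 h2
  rw [limitVariance]
  constructor
  · rw [le_div_iff₀ (by positivity)]
    refine le_trans (le_of_eq ?_) h1
    field_simp
    ring
  · rw [div_le_iff₀ (by positivity)]
    refine h2.trans (le_of_eq ?_)
    field_simp

theorem tendsto_limitVariance : Tendsto limitVariance atTop (𝓝 (1 / 2)) := by
  have h0 := tendsto_one_div_atTop_nhds_zero_nat (𝕜 := ℝ)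
  have h1 : Tendsto (fun l : ℕ => 1 / 2 - 1 / (l : ℝ)) atTop (𝓝 (1 / 2)) := by
    simpa only [sub_zero] using h0.const_sub (1 / 2)
  have h2 : Tendsto (fun l : ℕ => 1 / 2 + (1 / limitArea - 1) * (1 / (l : ℝ))) atTop
      (𝓝 (1 / 2)) := by
    simpa only [mul_zero, add_zero] using (h0.const_mul (1 / limitArea - 1)).const_add (1 / 2)
  exact tendsto_of_tendsto_of_tendsto_of_le_of_le' h1 h2
    ((eventually_gt_atTop 0).mono fun l hl => (limitVariance_bounds hl).1)
    ((eventually_gt_atTop 0).mono fun l hl => (limitVariance_bounds hl).2)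

/-- A lower bound for the free area after at most `l m` darts. -/
noncomputable def minFreeArea (l : ℕ) : ℝ := l * (limitArea * exp (-(2 * l)))

theorem minFreeArea_pos {l : ℕ} (hl : 1 ≤ l) : 0 < minFreeArea l := by
  have := limitArea_pos
  have : (0 : ℝ) < l := by exact_mod_cast hl
  rw [minFreeArea]
  positivity

/-- Fewer than `l * m` darts leave at least `l * m` of the `2 * (l * m)` largest cells free. The
bound is independent of `m`, so 1/P is uniformly bounded. -/
theorem minFreeArea_le (hY : ∀ m, IsIIDSequence μ (cellLaw m) (Y m)) {l m k : ℕ} (hm : 0 < m)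
    (hk : k < l * m) (y : ℕ → Option (Fin m × ℕ)) :
    minFreeArea l ≤ freeArea (cellLaw m) (occupied y k) := by
  have : NeZero m := ⟨hm.ne'⟩
  have := (hY m).isProbabilityMeasure_law
  refine le_trans (le_of_eq ?_) (mul_cellArea_le_freeArea (r := l * m) (N := 2 * (l * m))
    (by omega) y)
  have hm' : (m : ℝ) ≠ 0 := by exact_mod_cast hm.ne'
  push_cast
  rw [mul_assoc, mul_cellArea hm, minFreeArea]
  push_cast
  congr 4
  field_simp

theorem tendsto_integral_inv_freeArea (hY : ∀ m, IsIIDSequence μ (cellLaw m) (Y m)) {l : ℕ}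
    (hl : 1 ≤ l) {x : ℝ} (hx : 0 < x) (hxl : x < l) :
    Tendsto (fun m : ℕ => ∫ ω, 1 / freeArea (cellLaw m)
      (occupied (fun i => Y m i ω) ⌊(m : ℝ) * x⌋₊) ∂μ) atTop (𝓝 (1 / limitFreeArea x)) := by
  have hδ := minFreeArea_pos hl
  have hlt : ∀ m : ℕ, 0 < m → ⌊(m : ℝ) * x⌋₊ < l * m := by
    intro m hm
    have hm' : (0 : ℝ) < m := by exact_mod_cast hm
    rw [Nat.floor_lt (by positivity)]
    push_cast
    nlinarith
  have hle : ∀ m : ℕ, ⌊(m : ℝ) * x⌋₊ ≤ l * m := by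
    intro m
    rcases Nat.eq_zero_or_pos m with rfl | hm
    · simp
    · exact (hlt m hm).le
  have hn : Tendsto (fun m : ℕ => (⌊(m : ℝ) * x⌋₊ : ℝ) / m) atTop (𝓝 x) := by
    have := (tendsto_nat_floor_mul_div_atTop hx.le).comp (tendsto_natCast_atTop_atTop (R := ℝ))
    refine this.congr fun m => ?_
    simp [mul_comm]
  have hpos : 0 < limitFreeArea x := by
    have := hx.trans_le (inv_limitFreeArea_bounds hx).1
    exact one_div_pos.1 this
  have h := tendsto_integral_filter_of_dominated_convergence (l := atTop) (μ := μ)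
    (F := fun (m : ℕ) ω => 1 / freeArea (cellLaw m)
      (occupied (fun i => Y m i ω) ⌊(m : ℝ) * x⌋₊)) (f := fun _ => 1 / limitFreeArea x)
    (fun _ => 1 / minFreeArea l)
    ((eventually_gt_atTop 0).mono fun m hm => ((hY m).integrable_inv_freeArea hδ fun y =>
      minFreeArea_le hY hm (hlt m hm) y).aestronglyMeasurable)
    ((eventually_gt_atTop 0).mono fun m hm => ae_of_all _ fun ω => by
      rw [norm_of_nonneg (one_div_nonneg.2 (freeArea_nonneg _))]
      exact one_div_le_one_div_of_le hδ (minFreeArea_le hY hm (hlt m hm) _))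
    (integrable_const _) (by
      filter_upwards [ae_tendsto_freeArea hY hle hn] with ω hω
      exact tendsto_const_nhds.div hω hpos.ne')
  simpa using h

/-- The normalized variance formula is 1/l² times a Riemann sum of E[1/P] - 1 on [0, l]. -/
theorem tendsto_variance_estimate (hY : ∀ m, IsIIDSequence μ (cellLaw m) (Y m)) {l : ℕ}
    (hl : 1 ≤ l) :
    Tendsto (fun m : ℕ => (m : ℝ) * (Var[fun ω => estimate (cellLaw m) (fun i => Y m i ω) (l * m);
      μ] / ((l * m : ℕ) : ℝ) ^ 2)) atTop (𝓝 (limitVariance l)) := by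
  have hδ := minFreeArea_pos hl
  have h := tendsto_sum_range_div (f := fun m k => ∫ ω, 1 / freeArea (cellLaw m)
      (occupied (fun i => Y m i ω) k) ∂μ - 1) (F := fun x => 1 / limitFreeArea x - 1)
      (B := 1 / minFreeArea l + 1) l (fun m k hm hk => ?_) fun x hx hxl =>
        (tendsto_integral_inv_freeArea hY hl hx hxl).sub_const 1
  · refine (h.div_const ((l : ℝ) ^ 2)).congr' ((eventually_gt_atTop 0).mono fun m hm => ?_)
    have hm' : (m : ℝ) ≠ 0 := by exact_mod_cast hm.ne'
    have hl' : (l : ℝ) ≠ 0 := by exact_mod_cast (by omega : l ≠ 0)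
    simp only
    rw [(hY m).variance_estimate hδ fun k hk y => minFreeArea_le hY hm hk y, ← Finset.sum_div]
    push_cast
    field_simp
  · have h0 : 0 ≤ ∫ ω, 1 / freeArea (cellLaw m) (occupied (fun i => Y m i ω) k) ∂μ :=
      integral_nonneg fun ω => one_div_nonneg.2 (freeArea_nonneg _)
    have h1 : ∫ ω, 1 / freeArea (cellLaw m) (occupied (fun i => Y m i ω) k) ∂μ ≤
        1 / minFreeArea l := by
      have := integral_mono ((hY m).integrable_inv_freeArea hδ fun y => minFreeArea_le hY hm hk y)
        (integrable_const (1 / minFreeArea l)) fun ω =>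
          one_div_le_one_div_of_le hδ (minFreeArea_le hY hm hk _)
      simpa using this
    rw [abs_le]
    constructor <;> linarith

/-- The entropy, in nats, of the set of occupied cells. -/
noncomputable def occupiedEntropy (μ : Measure Ω) (Y : (m : ℕ) → ℕ → Ω → Option (Fin m × ℕ))
    (m n : ℕ) : ℝ :=
  ∑' s, negMulLog (μ.real ((fun ω => occupied (fun i => Y m i ω) n) ⁻¹' {s}))

theorem summable_occupiedEntropy (hY : ∀ m, IsIIDSequence μ (cellLaw m) (Y m)) {m : ℕ} (hm : 0 < m)
    (n : ℕ) :
    (Summable fun s => negMulLog (μ.real ((fun ω => occupied (fun i => Y m i ω) n) ⁻¹' {s}))) ∧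
    occupiedEntropy μ Y m n ≤ ∑' k, binEntropy ((1 - cellArea m k) ^ n) := by
  have : NeZero m := ⟨hm.ne'⟩
  have h1 := (hY m).measurableSet_mem_occupied n
  have h2 : Summable fun c => binEntropy (μ.real {ω | c ∉ occupied (fun i => Y m i ω) n}) := by
    simp_rw [(hY m).measureReal_notMem_occupied, cellLaw_real_some]
    exact ((cellRank m).summable_iff (f := fun k => binEntropy ((1 - cellArea m k) ^ n))).2
      (summable_binEntropy_cellArea hm n)
  refine ⟨summable_negMulLog h1 h2, (tsum_negMulLog_le h1 h2).trans_eq ?_⟩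
  simp_rw [(hY m).measureReal_notMem_occupied]
  exact tsum_cellRank fun a => binEntropy ((1 - a) ^ n)

theorem le_occupiedEntropy (hY : ∀ m, IsIIDSequence μ (cellLaw m) (Y m)) {m : ℕ} (hm : 0 < m)
    (n N : ℕ) {B : ℝ} (hB : B < 1) {ε K : ℝ}
    (hK0 : 0 ≤ K) (hK : ∀ p ∈ Set.Icc (0 : ℝ) 1, ∀ q ∈ Set.Icc (0 : ℝ) 1,
      binEntropy q - binEntropy p ≤ ε + K * (p - q) ^ 2)
    (hA : ∑ k ∈ Finset.range N, cellArea m k ≤ B) :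
    ∑ k ∈ Finset.range N, binEntropy ((1 - cellArea m k) ^ n) - N * ε -
      N * (K * (n * ((1 / m) ^ 2 / (1 - B)))) ≤ occupiedEntropy μ Y m n := by
  have : NeZero m := ⟨hm.ne'⟩
  have h1 := (hY m).sum_sub_le_partialEntropy n hB hK0 hK (largestCells m N) (by
    rw [sum_largestCells N fun a => a]
    exact hA)
  rw [sum_largestCells N fun a => binEntropy ((1 - a) ^ n) - ε - K * (n * (a ^ 2 / (1 - B)))] at h1
  refine le_trans ?_ (h1.trans (partialEntropy_le_tsum ((hY m).measurableSet_mem_occupied n)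
    (summable_occupiedEntropy hY hm n).1 _))
  rw [Finset.sum_sub_distrib, Finset.sum_sub_distrib, Finset.sum_const, Finset.card_range,
    nsmul_eq_mul]
  refine sub_le_sub_left ?_ _
  refine (Finset.sum_le_card_nsmul _ _ (K * (n * ((1 / m) ^ 2 / (1 - B)))) fun k _ => ?_).trans_eq
    (by simp)
  have h0 := cellArea_nonneg m k
  have h2 := cellArea_le m k
  have h3 : 0 < 1 - B := by linarith
  gcongr

/-- The total area tends to `limitArea`, which is below 1 because of the dummy cells; the bound is
the midpoint between `limitArea` and 1. -/
theorem eventually_sum_cellArea_le :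
    ∀ᶠ m : ℕ in atTop, ∀ N, ∑ k ∈ Finset.range N, cellArea m k ≤ (1 + limitArea) / 2 := by
  have h := tendsto_tsum_cellArea_mul_pow (n := fun _ => 0) (t := 0) (by simp)
  simp only [pow_zero, mul_one] at h
  rw [limitFreeArea_zero] at h
  have hlt : limitArea < (1 + limitArea) / 2 := by linarith [limitArea_lt_one]
  filter_upwards [h.eventually_lt_const hlt, eventually_gt_atTop 0] with m hm hm0 N
  refine le_trans (Summable.sum_le_tsum _ (fun k _ => cellArea_nonneg m k) ?_) hm.le
  have h1 := (hasSum_div_of_le hm0 (f := fun k => m * cellArea m k) (integrableOn_exp_sub 1)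
    fun x _ => by
      have := abs_mul_cellArea_mul_pow_le hm0 0 x
      simpa using this).summable
  have hm' : (m : ℝ) ≠ 0 := by exact_mod_cast hm0.ne'
  refine h1.congr fun k => ?_
  field_simp

theorem tendsto_occupiedEntropy (hY : ∀ m, IsIIDSequence μ (cellLaw m) (Y m)) (l : ℕ) :
    Tendsto (fun m => occupiedEntropy μ Y m (l * m) / m) atTop
      (𝓝 (limitEntropy (limitArea * l))) := by
  have hc := limitArea_pos
  refine tendsto_order.2 ⟨fun a ha => ?_, fun a ha => ?_⟩
  -- The gap η is spent in quarters: cutting the integral at `J`, the error ε of `J * m` cells, the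
  -- variance term of order 1/m, and the Riemann sum.
  · set η := limitEntropy (limitArea * l) - a
    have hη : 0 < η := sub_pos.2 ha
    have hJ : Tendsto (fun J : ℕ => ∫ x in (0 : ℝ)..J, binEntropy (exp (-(limitArea * l * exp (-x)))))
        atTop (𝓝 (limitEntropy (limitArea * l))) :=
      intervalIntegral_tendsto_integral_Ioi 0
        (integrableOn_binEntropy_exp (by positivity)) tendsto_natCast_atTop_atTop
    obtain ⟨J, hJ1⟩ := (hJ.eventually_const_lt (show limitEntropy (limitArea * l) - η / 4 <
      limitEntropy (limitArea * l) by linarith)).exists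
    obtain ⟨K, hK0, hK⟩ := exists_binEntropy_sub_le (ε := η / (4 * (J + 1))) (by positivity)
    set B := (1 + limitArea) / 2
    have hB : B < 1 := by
      have := limitArea_lt_one
      simp only [B]
      linarith
    have herr : Tendsto (fun m : ℕ => J * (K * l / (1 - B)) * (1 / (m : ℝ))) atTop (𝓝 0) := by
      simpa using (tendsto_one_div_atTop_nhds_zero_nat (𝕜 := ℝ)).const_mul (J * (K * l / (1 - B)))
    filter_upwards [eventually_gt_atTop 0, eventually_sum_cellArea_le,
      herr.eventually_lt_const (show 0 < η / 4 by linarith),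
      (tendsto_sum_range_binEntropy l J).eventually_const_lt
        (show _ - η / 4 < _ from sub_lt_self _ (by linarith))] with m hm hA herr hsum
    have hm' : (0 : ℝ) < m := by exact_mod_cast hm
    have h := le_occupiedEntropy hY hm (l * m) (J * m) hB hK0 hK (hA _)
    have h2 := div_le_div_of_nonneg_right h hm'.le
    refine lt_of_lt_of_le ?_ h2
    have hB' : 1 - B ≠ 0 := by linarith
    have e : (∑ k ∈ Finset.range (J * m), binEntropy ((1 - cellArea m k) ^ (l * m)) -
        ((J * m : ℕ) : ℝ) * (η / (4 * (J + 1))) -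
        ((J * m : ℕ) : ℝ) * (K * (((l * m : ℕ) : ℝ) * ((1 / (m : ℝ)) ^ 2 / (1 - B))))) / m =
        (∑ k ∈ Finset.range (J * m), binEntropy ((1 - cellArea m k) ^ (l * m))) / m -
        J * (η / (4 * (J + 1))) - J * (K * l / (1 - B)) * (1 / (m : ℝ)) := by
      push_cast
      field_simp
    rw [e]
    have h3 : J * (η / (4 * (J + 1))) ≤ η / 4 := by
      have hJ0 : (0 : ℝ) ≤ J := J.cast_nonneg
      rw [mul_div_assoc', div_le_div_iff₀ (by positivity) (by norm_num)]
      nlinarith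
    have h4 : a = limitEntropy (limitArea * l) - η := by simp [η]
    rw [h4]
    linarith
  · filter_upwards [(tendsto_tsum_binEntropy l).eventually_lt_const ha, eventually_gt_atTop 0] with
      m h hm
    have hm' : (0 : ℝ) < m := by exact_mod_cast hm
    exact (div_le_div_of_nonneg_right (summable_occupiedEntropy hY hm (l * m)).2 hm'.le).trans_lt h

end Limits

/-! ### Algebra of iterated limits -/

section IteratedLimits

theorem HasIteratedLimit.mul {f g : ℕ → ℕ → ℝ} {a b : ℝ} (hf : HasIteratedLimit f a)
    (hg : HasIteratedLimit g b) : HasIteratedLimit (fun l m => f l m * g l m) (a * b) := by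
  obtain ⟨L, h1, h2⟩ := hf
  obtain ⟨M, h3, h4⟩ := hg
  exact ⟨fun l => L l * M l, fun l hl => (h1 l hl).mul (h3 l hl), h2.mul h4⟩

theorem HasIteratedLimit.congr {f g : ℕ → ℕ → ℝ} {a : ℝ} (hf : HasIteratedLimit f a)
    (h : ∀ l m, 0 < m → f l m = g l m) : HasIteratedLimit g a := by
  obtain ⟨L, h1, h2⟩ := hf
  exact ⟨L, fun l hl => (h1 l hl).congr' ((eventually_gt_atTop 0).mono fun m hm => h l m hm), h2⟩

theorem HasIteratedLimit.add_null {f g : ℕ → ℕ → ℝ} {a : ℝ} (hf : HasIteratedLimit f a)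
    (hg : ∀ l, 1 ≤ l → Tendsto (fun m => g l m) atTop (𝓝 0)) :
    HasIteratedLimit (fun l m => f l m + g l m) a := by
  obtain ⟨L, h1, h2⟩ := hf
  exact ⟨L, fun l hl => by simpa using (h1 l hl).add (hg l hl), h2⟩

end IteratedLimits

/-! ### Translation to the sketch and its estimator -/

section Fishmonger

variable {Ω : Type*} [MeasurableSpace Ω] {μ : Measure Ω} [IsProbabilityMeasure μ]
  {dart : ℕ → ℕ → Ω → ℝ × ℝ}

theorem cellArea_pos {m : ℕ} (hm : 0 < m) (k : ℕ) : 0 < cellArea m k := by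
  have := limitArea_pos
  have : (0 : ℝ) < m := by exact_mod_cast hm
  rw [cellArea]
  positivity

theorem memLp_martingaleEstimator
    (hY : ∀ m, IsIIDSequence μ (cellLaw m) fun k ω => cellOf (Real.exp 1) m (dart m k ω))
    (m n : ℕ) :
    MemLp (fun ω => martingaleEstimator (Real.exp 1) m (fun k => dart m k ω) n) 2 μ := by
  simp_rw [martingaleEstimator_eq_estimate]
  rcases Nat.eq_zero_or_pos m with rfl | hm
  -- Without columns there are no cells, the state never changes and the estimator is zero.
  · have : ∀ y : ℕ → Option (Fin 0 × ℕ), estimate (cellLaw 0) y n = 0 := fun y =>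
      Finset.sum_eq_zero fun k _ => by
        rw [if_neg]
        simp [Finset.eq_empty_of_isEmpty]
    simp_rw [this]
    exact MemLp.zero'
  · have : NeZero m := ⟨hm.ne'⟩
    have := (hY m).isProbabilityMeasure_law
    refine (hY m).memLp_estimate (cellArea_pos hm n) fun k hk y => ?_
    -- Before the n-th dart at least one of the `n` largest cells is free, which is enough for a
    -- fixed `m`.
    have := mul_cellArea_le_freeArea (m := m) (k := k) (r := 1) (N := n) hk y
    simpa using this

theorem entropyTerm_sketch (m n : ℕ) (s : Finset (Fin m × ℕ)) :
    entropyTerm μ (fun ω => sketch (Real.exp 1) m (fun k => dart m k ω) n) s =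
      Real.negMulLog (μ.real ((fun ω => occupied (fun k => cellOf (Real.exp 1) m (dart m k ω)) n) ⁻¹'
        {s})) / Real.log 2 := by
  simp_rw [sketch_eq_occupied]
  rw [entropyTerm, Real.negMulLog, Real.logb]
  ring

theorem summable_entropyTerm
    (hY : ∀ m, IsIIDSequence μ (cellLaw m) fun k ω => cellOf (Real.exp 1) m (dart m k ω))
    (m n : ℕ) :
    Summable (entropyTerm μ (fun ω => sketch (Real.exp 1) m (fun k => dart m k ω) n)) := by
  rcases Nat.eq_zero_or_pos m with rfl | hm
  · exact (hasSum_fintype _).summable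
  · simp_rw [funext (entropyTerm_sketch m n)]
    exact (summable_occupiedEntropy hY hm n).1.div_const _

theorem fishmongerEntropy_eq (m n : ℕ) :
    fishmongerEntropy μ dart m n =
      occupiedEntropy μ (fun m k ω => cellOf (Real.exp 1) m (dart m k ω)) m n / Real.log 2 := by
  rw [fishmongerEntropy, entropyBits, occupiedEntropy, ← tsum_div_const]
  exact tsum_congr fun s => entropyTerm_sketch m n s

theorem isScaleInvariant_changeProb
    (hY : ∀ m, IsIIDSequence μ (cellLaw m) fun k ω => cellOf (Real.exp 1) m (dart m k ω)) :
    IsScaleInvariant μ (fun m k ω => changeProb (Real.exp 1) m (fun i => dart m i ω) k) 1 := by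
  refine ⟨fun l => l * limitFreeArea l, fun l hl => ?_, ?_⟩
  · simp_rw [changeProb_eq_freeArea]
    -- `changeProb` at index `l * m` refers to the state after `l * m - 1` darts; the shift vanishes
    -- after division by `m`.
    filter_upwards [ae_tendsto_freeArea hY (n := fun m => l * m - 1) (B := l)
      (fun m => Nat.sub_le _ _) (tendsto_mul_sub_one_div hl)] with ω hω
    exact hω.const_mul _
  · have h := tendsto_exp_neg_mul_natCast.const_sub 1
    rw [sub_zero] at h
    refine h.congr' ((eventually_gt_atTop 0).mono fun l hl => ?_)
    have hl' : (0 : ℝ) < l := by exact_mod_cast hl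
    simp only [limitFreeArea_eq hl']
    field_simp

theorem hasIteratedLimit_variance
    (hY : ∀ m, IsIIDSequence μ (cellLaw m) fun k ω => cellOf (Real.exp 1) m (dart m k ω)) :
    HasIteratedLimit (fun l m => (m : ℝ) * fishmongerRelVar μ dart m (l * m)) (1 / 2) := by
  refine ⟨limitVariance, fun l hl => ?_, tendsto_limitVariance⟩
  simp_rw [fishmongerRelVar, martingaleEstimator_eq_estimate]
  exact tendsto_variance_estimate hY hl

theorem hasIteratedLimit_entropy
    (hY : ∀ m, IsIIDSequence μ (cellLaw m) fun k ω => cellOf (Real.exp 1) m (dart m k ω)) :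
    HasIteratedLimit (fun l m => fishmongerEntropy μ dart m (l * m) / (m : ℝ)) H0 := by
  refine ⟨fun l => limitEntropy (limitArea * l) / Real.log 2, fun l _ => ?_, ?_⟩
  · simp_rw [fishmongerEntropy_eq, div_right_comm _ (Real.log 2)]
    exact (tendsto_occupiedEntropy hY l).div_const _
  · rw [H0_eq]
    exact (tendsto_limitEntropy.comp
      (tendsto_natCast_atTop_atTop.const_mul_atTop limitArea_pos)).div_const _

end Fishmonger

end Dartboard

theorem mainTheorem4 {Ω : Type*} [MeasurableSpace Ω] (μ : Measure Ω) [IsProbabilityMeasure μ]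
    (dart : ℕ → ℕ → Ω → ℝ × ℝ)
    (dart_measurable : ∀ m k, Measurable (dart m k))
    (dart_law : ∀ m k, μ.map (dart m k) = dartLaw)
    (dart_indep : ∀ m, iIndepFun (dart m) μ) :
    -- all variances and entropies below are finite
    (∀ m n, MemLp (fun ω => martingaleEstimator (Real.exp 1) m (fun k => dart m k ω) n) 2 μ) ∧
    (∀ m n, Summable
      (entropyTerm μ (fun ω => sketch (Real.exp 1) m (fun k => dart m k ω) n))) ∧
    -- scale-invariance with `κ = 1`
    IsScaleInvariant μ (fun m k ω => changeProb (Real.exp 1) m (fun i => dart m i ω) k) 1 ∧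
    -- the ARV factor is `1 / 2`, and the entropy per column is `H₀`
    HasIteratedLimit (fun l m => (m : ℝ) * fishmongerRelVar μ dart m (l * m)) (1 / 2) ∧
    HasIteratedLimit (fun l m => fishmongerEntropy μ dart m (l * m) / (m : ℝ)) H0 ∧
    -- the limiting memory-variance product is `H₀ / 2`
    HasIteratedLimit
      (fun l m => fishmongerEntropy μ dart m (l * m) * fishmongerRelVar μ dart m (l * m))
      (H0 / 2) ∧
    -- the same if the memory exceeds the entropy by `o(m)` bits, such as a register that
    -- holds the estimate
    (∀ b : ℕ → ℕ → ℝ,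
      (∀ l, 1 ≤ l → Tendsto (fun m : ℕ => b m (l * m) / (m : ℝ)) atTop (𝓝 0)) →
      HasIteratedLimit
        (fun l m => (fishmongerEntropy μ dart m (l * m) + b m (l * m)) *
          fishmongerRelVar μ dart m (l * m))
        (H0 / 2)) ∧
    -- numerical value, correct to two decimals
    |H0 / 2 - 1.63| < 0.005 := by
  have hY := isIIDSequence_cellOf dart_measurable dart_law dart_indep
  have hvar := hasIteratedLimit_variance hY
  have hent := hasIteratedLimit_entropy hY
  -- The factor `m` cancels between the entropy per column and the variance factor, so the product
  -- limit follows from the two separate limits.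
  have hprod : ∀ h v : ℝ, ∀ m : ℕ, 0 < m → h / m * (m * v) = h * v := fun h v m hm => by
    have : (m : ℝ) ≠ 0 := by exact_mod_cast hm.ne'
    field_simp
  rw [div_eq_mul_one_div H0 2]
  refine ⟨memLp_martingaleEstimator hY, summable_entropyTerm hY, isScaleInvariant_changeProb hY,
    hvar, hent, (hent.mul hvar).congr fun l m hm => hprod _ _ m hm, fun b hb => ?_, ?_⟩
  · refine ((hent.add_null hb).mul hvar).congr fun l m hm => ?_
    rw [← add_div]
    exact hprod _ _ m hm
  · rw [← div_eq_mul_one_div]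
    exact abs_H0_div_two_sub_lt
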